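/- **Theorem B.** Let $1<p<\infty$, $p'=p/(p-1)$ and $\alpha>1$. Let $\mathcal X$ be a radial tree with origin $0$: a tree in which every vertex $x$ has exactly $q(|x|)$ children, where $|x|=d(x,0)$ and $q:\{0,1,2,\dots\}\to\{2,3,\dots\}$ is arbitrary, possibly unbounded (so $0$ has $q(0)$ neighbours and every other vertex $x$ has $q(|x|)+1$). Let $\mu(\{x\})=\prod_{\ell=0}^{|x|-1}q(\ell)^{-\alpha}$. For a vertex $x$ let $S_x$ be the set consisting of $x$ and all its descendants, and let $\mathscr D$ be the collection of all sectors $S_x$ and all singletons $\{x\}$, $x\in\mathcal X$. The parent $Q^{(1)}$ of $Q\in\mathscr D$, $Q\ne\mathcal X$, is given by $\{x\}^{(1)}=S_x$, and by $S_y^{(1)}=S_x$ if $y$ is a child of $x$. With $\langle f\rangle_Q=\mu(Q)^{-1}\sum_{x\in Q}f(x)\mu(\{x\})$, put for $w:\mathcal X\to(0,\infty)$ $$[w]_{\mathcal B_p(\mu)}=\sup_{Q\in\mathscr D}\langle w\rangle_Q\langle w^{-p'/p}\rangle_Q^{p/p'},\qquad [w]_{\tilde{\mathcal B}_p(\mu)}=\sup_{Q,R\in\mathscr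 D,\ Q^{(1)}=R^{(1)}}\langle w\rangle_Q\langle w^{-p'/p}\rangle_R^{p/p'},$$ and let $\tilde{\mathcal B}_p(\mu)$ be the class of those $w$ with $[w]_{\tilde{\mathcal B}_p(\mu)}<\infty$. Let $\mathcal P$ be the orthogonal projection of $L^2(\mathcal X,\mu)$ (real scalars) onto the Bergman space of those $f\in L^2(\mathcal X,\mu)$ that are harmonic (the value at each vertex is the mean of the values at its neighbours), and let $K(x,y)=\mu(\{x\})^{-1}(\mathcal P1_{\{x\}})(y)$ be its kernel. Write $\|f\|_{L^p(\mathcal X,w)}^p=\sum_x|f(x)|^pw(x)\mu(\{x\})$. There is a constant $C>0$ depending only on $p$ and $\alpha$ such that for every such tree and every $w\in\tilde{\mathcal B}_p(\mu)$ one has $[w]_{\mathcal B_p(\mu)}\le[w]_{\tilde{\mathcal B}_p(\mu)}$, and for every $f\in L^p(\mathcal X,w)$: the sum $\mathcal Pf(x)=\sum_yK(x,y)f(y)\mu(\{y\})$ converges absolutely for every $x$; it coincides with the orthogonal projection of $f$ if also $f\in L^2(\mathcal X,\mu)$; and $\mathcal P f\in L^p(\mathcal X,w)$ with $$\|\mathcal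 Pf\|_{L^p(\mathcal X,w)}\le C\,[w]_{\tilde{\mathcal B}_p(\mu)}^{1/p}\,[w]_{\mathcal B_p(\mu)}^{p'/p^2+1/p'}\,\|f\|_{L^p(\mathcal X,w)}.$$ -/

import Mathlib

open MeasureTheory
open scoped ENNReal

noncomputable section

/-- A radial tree with vertex set `V`: a tree with a distinguished origin `root` (denoted `0`
in the comments below) in which a vertex at distance `ℓ` from the origin has exactly `q ℓ ≥ 2`
children. Thus the origin has `q 0` neighbours, and every other vertex `x` has `q |x| + 1`. -/
structure RadialTree (V : Type*) where
  graph : SimpleGraph V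
  root : V
  q : ℕ → ℕ
  isTree : graph.IsTree
  [locallyFinite : graph.LocallyFinite]
  two_le_q : ∀ ℓ, 2 ≤ q ℓ
  degree_root : graph.degree root = q 0
  degree_of_ne_root : ∀ x, x ≠ root → graph.degree x = q (graph.dist root x) + 1

namespace RadialTree

attribute [instance] RadialTree.locallyFinite

variable {V : Type*} (T : RadialTree V)

/-- `|x|`, the distance from `x` to the origin. -/
def level (x : V) : ℕ := T.graph.dist T.root x

/-- The mass `μ({x}) = ∏_{ℓ < |x|} q(ℓ)^{-α}`. -/
def mass (α : ℝ) (x : V) : ℝ := ∏ ℓ ∈ Finset.range (T.level x), ((T.q ℓ : ℝ) ^ α)⁻¹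

theorem mass_pos (α : ℝ) (x : V) : 0 < T.mass α x := by
  refine Finset.prod_pos fun ℓ _ => inv_pos.2 (Real.rpow_pos_of_pos ?_ α)
  have := T.two_le_q ℓ
  exact_mod_cast (by omega : 0 < T.q ℓ)

/-- The sector generated by `x`: the vertex `x` and all its descendants, that is, the vertices `y`
such that `x` lies on the geodesic from the origin to `y`. -/
def sector (x : V) : Set V := {y | T.level y = T.level x + T.graph.dist x y}

/-- The partition `𝒟_k`, made of the points of level `< k` and the sectors of level `k`. -/
def partition (k : ℕ) : Set (Set V) :=
  {Q | (∃ x, T.level x < k ∧ Q = {x}) ∨ ∃ y, T.level y = k ∧ Q = T.sector y}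

/-- The system `𝒟 = ⋃_k 𝒟_k`. -/
def dyadic : Set (Set V) := {Q | ∃ k, Q ∈ T.partition k}

/-- `P = Q^{(1)}`: if `k + 1` is the smallest generation to which `Q` belongs, then `P` is the
element of generation `k` that contains `Q`. Thus `S_y^{(1)} = S_x` if `y` is a child of `x`, and
`{x}^{(1)} = S_x`. The whole tree has no parent. -/
def IsParent (P Q : Set V) : Prop :=
  ∃ k, IsLeast {j | Q ∈ T.partition j} (k + 1) ∧ P ∈ T.partition k ∧ Q ⊆ P

/-- `Q, R ∈ 𝒟` with `Q^{(1)} = R^{(1)}` (the case `Q = R` is included). -/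
def IsSibling (Q R : Set V) : Prop := ∃ P, T.IsParent P Q ∧ T.IsParent P R

/-- The value at `x` of the combinatorial Laplacian: `f x` minus the mean of `f` over the
neighbours of `x`. -/
def laplacian (f : V → ℝ) (x : V) : ℝ :=
  f x - (T.graph.degree x : ℝ)⁻¹ * ∑ y ∈ T.graph.neighborFinset x, f y

variable [MeasurableSpace V]

/-- The measure `μ` on the tree. -/
def measure (α : ℝ) : Measure V :=
  Measure.sum fun x => ENNReal.ofReal (T.mass α x) • Measure.dirac x

variable [DiscreteMeasurableSpace V]

theorem measure_singleton (α : ℝ) (x : V) :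
    T.measure α {x} = ENNReal.ofReal (T.mass α x) := by
  classical
  rw [measure, Measure.sum_apply _ (MeasurableSet.of_discrete), tsum_eq_single x]
  · simp
  · intro y hy
    simp [hy]

theorem eq_of_ae_eq {α : ℝ} {f g : V → ℝ} (h : f =ᵐ[T.measure α] g) (x : V) : f x = g x := by
  by_contra hx
  have h0 : T.measure α {x} = 0 := measure_mono_null (by simpa using hx) h
  rw [measure_singleton, ENNReal.ofReal_eq_zero] at h0
  exact absurd (T.mass_pos α x) (not_lt.2 h0)

/-- The Bergman space: the harmonic functions in `L²(μ)`. As every point has positive mass, an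
element of `L²(μ)` is a function on the tree. -/
def bergmanSpace (α : ℝ) : Submodule ℝ (Lp ℝ 2 (T.measure α)) where
  carrier := {f | ∀ x, T.laplacian f x = 0}
  zero_mem' x := by
    have h : ⇑(0 : Lp ℝ 2 (T.measure α)) = fun _ => (0 : ℝ) :=
      funext fun y => T.eq_of_ae_eq (Lp.coeFn_zero ℝ 2 (T.measure α)) y
    change T.laplacian ⇑(0 : Lp ℝ 2 (T.measure α)) x = 0
    rw [h]
    simp [laplacian]
  add_mem' {f g} hf hg x := by
    have h : ∀ y, (f + g : Lp ℝ 2 (T.measure α)) y = f y + g y :=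
      fun y => T.eq_of_ae_eq (Lp.coeFn_add f g) y
    have h1 := hf x
    have h2 := hg x
    simp only [laplacian, h, Finset.sum_add_distrib] at h1 h2 ⊢
    linear_combination h1 + h2
  smul_mem' c f hf x := by
    have h : ∀ y, (c • f : Lp ℝ 2 (T.measure α)) y = c * f y :=
      fun y => T.eq_of_ae_eq (Lp.coeFn_smul c f) y
    have h1 := hf x
    simp only [laplacian, h, ← Finset.mul_sum] at h1 ⊢
    linear_combination c * h1

/-- Point evaluations are continuous on `L²(μ)`. -/
theorem continuous_eval (α : ℝ) (x : V) :
    Continuous fun f : Lp ℝ 2 (T.measure α) => f x := by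
  have hfin : T.measure α {x} ≠ ∞ := by simp [measure_singleton]
  have hm : T.mass α x ≠ 0 := (T.mass_pos α x).ne'
  have key : ∀ f : Lp ℝ 2 (T.measure α), f x = (T.mass α x)⁻¹ *
      inner ℝ (indicatorConstLp 2 (MeasurableSet.of_discrete (s := {x})) hfin (1 : ℝ)) f := by
    intro f
    rw [L2.inner_indicatorConstLp_one, integral_singleton, measureReal_def, measure_singleton,
      ENNReal.toReal_ofReal (T.mass_pos α x).le]
    simp [hm]
  simp_rw [key]
  fun_prop

theorem isClosed_bergmanSpace (α : ℝ) :
    IsClosed (T.bergmanSpace α : Set (Lp ℝ 2 (T.measure α))) := by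
  have h : (T.bergmanSpace α : Set (Lp ℝ 2 (T.measure α))) =
      ⋂ x, {f : Lp ℝ 2 (T.measure α) | T.laplacian f x = 0} := by
    ext f
    simp [bergmanSpace]
  rw [h]
  refine isClosed_iInter fun x => isClosed_eq ?_ continuous_const
  unfold laplacian
  exact (T.continuous_eval α x).sub (continuous_const.mul
    (continuous_finsetSum _ fun y _ => T.continuous_eval α y))

instance completeSpace_bergmanSpace (α : ℝ) : CompleteSpace (T.bergmanSpace α) :=
  (T.isClosed_bergmanSpace α).completeSpace_coe

/-- The orthogonal projection of `L²(μ)` onto the Bergman space. -/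
def bergmanProjection (α : ℝ) : Lp ℝ 2 (T.measure α) →L[ℝ] Lp ℝ 2 (T.measure α) :=
  (T.bergmanSpace α).starProjection

/-- The integral kernel of the projection, which is the reproducing kernel of the Bergman space:
`K(x, ·)` is the projection of `1_{x} / μ({x})`. -/
def bergmanKernel (α : ℝ) (x y : V) : ℝ :=
  (T.mass α x)⁻¹ * T.bergmanProjection α
    (indicatorConstLp 2 (MeasurableSet.of_discrete (s := {x}))
      (by simp [measure_singleton] : T.measure α {x} ≠ ∞) (1 : ℝ)) y

/-- The Bergman projector as an integral operator. -/
def bergmanOperator (α : ℝ) (f : V → ℝ) (x : V) : ℝ :=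
  ∫ y, T.bergmanKernel α x y * f y ∂T.measure α

/-- `⟨w⟩_Q ⟨w^{-p'/p}⟩_R^{p/p'}`, where `p' = p / (p - 1)`. -/
def testQuantity (α p : ℝ) (w : V → ℝ) (Q R : Set V) : ℝ≥0∞ :=
  (⨍⁻ x in Q, ENNReal.ofReal (w x) ∂T.measure α) *
    (⨍⁻ x in R, ENNReal.ofReal (w x ^ (-(p.conjExponent / p))) ∂T.measure α) ^
      (p / p.conjExponent)

/-- The constant `[w]_{ℬ_p(μ)}`. -/
def weightConst (α p : ℝ) (w : V → ℝ) : ℝ≥0∞ :=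
  ⨆ Q ∈ T.dyadic, T.testQuantity α p w Q Q

/-- The constant of the smaller class, tested on all pairs of siblings. -/
def siblingWeightConst (α p : ℝ) (w : V → ℝ) : ℝ≥0∞ :=
  ⨆ (Q : Set V) (R : Set V) (_ : T.IsSibling Q R), T.testQuantity α p w Q R

/-- The class of weights `w : V → (0, ∞)` whose sibling constant is finite. -/
def siblingWeights (α p : ℝ) : Set (V → ℝ) :=
  {w | (∀ x, 0 < w x) ∧ T.siblingWeightConst α p w < ∞}

/-- The measure `w dμ`. -/
def weightedMeasure (α : ℝ) (w : V → ℝ) : Measure V :=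
  (T.measure α).withDensity fun x => ENNReal.ofReal (w x)

end RadialTree

end

/-!
# Weighted estimates for the Bergman projection on a radial tree

**The kernel.** A harmonic function on a sector `S_y` is determined, after summation over the
generations of `S_y`, by its values at `y` and at the parent of `y` (`sum_descendants_of_harmonic`).
For `y` other than the origin let `radial y` be the function supported on `S_y` that depends on the
level only, equals `1` at `y`, and is harmonic except at the parent of `y`; its values on `S_y` lie
in `[1, 2]`. Subtracting the mean of the radial functions of the siblings makes it harmonic
(`harmonicRadial`), and the inner product of a harmonic function with the result is a combination
of two successive increments of the function. Along the path from the origin to `z` these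
combinations telescope, so that a sum over the ancestors of `z` reproduces the value at `z`
(`tsum_explicitKernel_mul`). As this sum is itself harmonic and bounded, it is the Bergman kernel
(`bergmanKernel_eq`).

**Domination.** The explicit formula shows that `|P f|` is at most a constant times the positive
operator `∑ c(y, y') ⟨|f|⟩_{S_y'} 1_{S_y}`, where `c(y, y')` is `1` for `y = y'`, plus the inverse of
the number of siblings when `y` and `y'` are siblings, equal or not (`tsum_enorm_explicitKernel_mul_le`). The
coefficients have bounded row and column sums, whereas `q` may be unbounded.

**The weighted estimate.** Let `σ = w^{-p'/p}` and pair the positive operator, applied to `h σ`,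
with `g` in `L²(w dμ)`. One factor `(⟨w⟩_{S_y} ⟨σ⟩_{S_y'}^{p/p'})^{1/p}` is bounded by the sibling
constant; what is left is split by Hölder's inequality into a sum of `(⟨h⟩^σ_{S_y'})^p σ(S_y')` and
a sum of `(⟨g⟩^w_{S_y})^{p'} w(S_y)` (`bilinear_le`). Both are controlled by Hardy's inequality for
averages over sectors (`hardy`), as `μ(S_y)` is comparable with `μ({y})`, so that the `ℬ_p`
condition on `S_y` bounds `w(S_y)` and `σ(S_y)` by multiples of `w({y})` and `σ({y})`
(`sectorSum_masses_le`). Hardy's inequality holds with a constant independent of the measure; it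
follows from a convexity inequality at each vertex (`hardy_vertex`), which telescopes along the
generations.
-/

noncomputable section

namespace RadialTree

variable {V : Type*} (T : RadialTree V)

/-! ### Parents, children and sectors -/

@[simp]
theorem level_root : T.level T.root = 0 := by simp [level]

theorem level_eq_zero_iff {x : V} : T.level x = 0 ↔ x = T.root := by
  rw [level, T.isTree.connected.dist_eq_zero_iff, eq_comm]

theorem level_of_adj {x y : V} (h : T.graph.Adj x y) :
    T.level x = T.level y + 1 ∨ T.level y = T.level x + 1 :=
  T.isTree.dist_eq_dist_add_one_of_adj T.root h

theorem exists_adj_level {x : V} (hx : x ≠ T.root) :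
    ∃ y, T.graph.Adj x y ∧ T.level x = T.level y + 1 := by
  obtain ⟨w, hw⟩ := T.isTree.connected.exists_walk_length_eq_dist T.root x
  have hn : ¬ w.Nil := fun h => hx h.eq.symm
  refine ⟨w.penultimate, (w.adj_penultimate hn).symm, ?_⟩
  have h1 : T.level w.penultimate ≤ w.dropLast.length := SimpleGraph.dist_le _
  have h2 : w.dropLast.length + 1 = w.length := w.length_dropLast_add_one hn
  have h3 : T.level x = w.length := hw.symm
  rcases T.level_of_adj (w.adj_penultimate hn) with h | h <;> omega

theorem eq_of_adj_level {x y y' : V} (hy : T.graph.Adj x y) (hy' : T.graph.Adj x y')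
    (h : T.level x = T.level y + 1) (h' : T.level x = T.level y' + 1) : y = y' := by
  obtain ⟨w, hw⟩ := T.isTree.connected.exists_walk_length_eq_dist T.root y
  obtain ⟨w', hw'⟩ := T.isTree.connected.exists_walk_length_eq_dist T.root y'
  have hp : (w.concat hy.symm).IsPath := SimpleGraph.Walk.isPath_of_length_eq_dist _ (by
    rw [SimpleGraph.Walk.length_concat, hw]; exact h.symm)
  have hp' : (w'.concat hy'.symm).IsPath := SimpleGraph.Walk.isPath_of_length_eq_dist _ (by
    rw [SimpleGraph.Walk.length_concat, hw']; exact h'.symm)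
  have he := (T.isTree.existsUnique_path T.root x).unique hp hp'
  have := congrArg SimpleGraph.Walk.penultimate he
  simpa using this

open Classical in
/-- The parent of a vertex: its neighbour one level closer to the origin. The origin is its own
parent, so that harmonicity takes the same form at all vertices (`laplacian_eq_zero_iff`). -/
def parent (x : V) : V :=
  if h : ∃ y, T.graph.Adj x y ∧ T.level x = T.level y + 1 then h.choose else x

theorem adj_parent {x : V} (hx : x ≠ T.root) : T.graph.Adj x (T.parent x) := by
  have h := T.exists_adj_level hx
  rw [parent, dif_pos h]
  exact h.choose_spec.1

theorem level_parent {x : V} (hx : x ≠ T.root) : T.level x = T.level (T.parent x) + 1 := by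
  have h := T.exists_adj_level hx
  rw [parent, dif_pos h]
  exact h.choose_spec.2

@[simp]
theorem parent_root : T.parent T.root = T.root := by
  rw [parent, dif_neg]
  rintro ⟨y, -, h⟩
  simp at h

/-- The children of a vertex. -/
def children (x : V) : Finset V := {y ∈ T.graph.neighborFinset x | T.level y = T.level x + 1}

theorem mem_children {x y : V} : y ∈ T.children x ↔ y ≠ T.root ∧ T.parent y = x := by
  simp only [children, Finset.mem_filter, SimpleGraph.mem_neighborFinset]
  constructor
  · rintro ⟨h, hl⟩
    have hy : y ≠ T.root := by
      rintro rfl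
      simp at hl
    exact ⟨hy, T.eq_of_adj_level (T.adj_parent hy) h.symm (T.level_parent hy) hl⟩
  · rintro ⟨hy, rfl⟩
    exact ⟨(T.adj_parent hy).symm, T.level_parent hy⟩

theorem mem_children_parent {x : V} (hx : x ≠ T.root) : x ∈ T.children (T.parent x) :=
  T.mem_children.2 ⟨hx, rfl⟩

theorem level_of_mem_children {x y : V} (h : y ∈ T.children x) : T.level y = T.level x + 1 :=
  (Finset.mem_filter.1 h).2

theorem parent_notMem_children (x : V) : T.parent x ∉ T.children x := by
  intro h
  have h1 := T.level_of_mem_children h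
  by_cases hx : x = T.root
  · subst hx; simp at h1
  · have := T.level_parent hx; omega

theorem neighborFinset_root : T.graph.neighborFinset T.root = T.children T.root := by
  ext y
  simp only [children, Finset.mem_filter, SimpleGraph.mem_neighborFinset, iff_self_and]
  intro h
  rcases T.level_of_adj h with h | h
  · simp at h
  · exact h

theorem neighborFinset_of_ne_root {x : V} (hx : x ≠ T.root) :
    T.graph.neighborFinset x = Finset.cons (T.parent x) (T.children x)
      (T.parent_notMem_children x) := by
  ext y
  simp only [children, Finset.mem_filter, SimpleGraph.mem_neighborFinset, Finset.mem_cons]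
  constructor
  · intro h
    rcases T.level_of_adj h with hl | hl
    · exact Or.inl (T.eq_of_adj_level h (T.adj_parent hx) hl (T.level_parent hx))
    · exact Or.inr ⟨h, hl⟩
  · rintro (rfl | h)
    · exact T.adj_parent hx
    · exact h.1

theorem card_children (x : V) : (T.children x).card = T.q (T.level x) := by
  by_cases hx : x = T.root
  · subst hx
    rw [← neighborFinset_root, SimpleGraph.card_neighborFinset_eq_degree, T.degree_root,
      level_root]
  · have h := T.degree_of_ne_root x hx
    rw [← SimpleGraph.card_neighborFinset_eq_degree, T.neighborFinset_of_ne_root hx,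
      Finset.card_cons] at h
    exact Nat.succ_injective h

theorem q_pos (ℓ : ℕ) : (0 : ℝ) < T.q ℓ := by
  have := T.two_le_q ℓ
  exact_mod_cast (by omega : 0 < T.q ℓ)

theorem self_mem_sector (x : V) : x ∈ T.sector x := by simp [sector]

theorem level_le_of_mem_sector {x z : V} (h : z ∈ T.sector x) : T.level x ≤ T.level z := by
  have : T.level z = _ := h
  omega

theorem eq_of_mem_sector_of_level_le {x z : V} (h : z ∈ T.sector x) (hl : T.level z ≤ T.level x) :
    z = x := by
  have h1 : T.level z = T.level x + T.graph.dist x z := h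
  exact (T.isTree.connected.dist_eq_zero_iff.1 (by omega)).symm

/-- A vertex other than `x` descends from `x` exactly when its parent belongs to the sector of `x`:
geodesics from the origin through `x` extend one edge at a time. -/
theorem mem_sector_iff_parent {x z : V} (hzx : z ≠ x) :
    z ∈ T.sector x ↔ z ≠ T.root ∧ T.parent z ∈ T.sector x := by
  have hc := T.isTree.connected
  constructor
  · intro h
    have hz : z ≠ T.root := by
      rintro rfl
      have := T.level_le_of_mem_sector h
      exact hzx (T.eq_of_mem_sector_of_level_le h (by simp))
    refine ⟨hz, ?_⟩
    have h1 : T.level z = T.level x + T.graph.dist x z := h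
    obtain ⟨w, hw⟩ := hc.exists_walk_length_eq_dist x z
    have hn : ¬ w.Nil := fun h => hzx h.eq.symm
    have h2 : T.graph.dist x w.penultimate ≤ w.dropLast.length := SimpleGraph.dist_le _
    have h3 : w.dropLast.length + 1 = w.length := w.length_dropLast_add_one hn
    have h4 : T.level w.penultimate ≤ T.level x + T.graph.dist x w.penultimate := hc.dist_triangle
    have h5 : T.level z = T.level w.penultimate + 1 := by
      rcases T.level_of_adj (w.adj_penultimate hn) with h | h <;> omega
    rw [← T.eq_of_adj_level (w.adj_penultimate hn).symm (T.adj_parent hz) h5 (T.level_parent hz)]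
    change T.level w.penultimate = _
    omega
  · rintro ⟨hz, h⟩
    have h1 : T.level (T.parent z) = T.level x + T.graph.dist x (T.parent z) := h
    have h2 := T.level_parent hz
    have h3 : T.level z ≤ T.level x + T.graph.dist x z := hc.dist_triangle
    have h4 : T.graph.dist x z ≤ T.graph.dist x (T.parent z) + T.graph.dist (T.parent z) z :=
      hc.dist_triangle
    rw [SimpleGraph.dist_eq_one_iff_adj.2 (T.adj_parent hz).symm] at h4
    change T.level z = _
    omega

@[simp]
theorem sector_root : T.sector T.root = Set.univ := by
  ext z
  simp [sector, level]

/-- Induction from parents to children. -/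
theorem parent_induction {P : V → Prop} (root : P T.root)
    (step : ∀ x, x ≠ T.root → P (T.parent x) → P x) (x : V) : P x := by
  induction h : T.level x generalizing x with
  | zero => rwa [T.level_eq_zero_iff.1 h]
  | succ n ih =>
    have hx : x ≠ T.root := by
      rintro rfl
      simp at h
    exact step x hx (ih _ (by have := T.level_parent hx; omega))

theorem sector_subset_sector_parent (y : V) : T.sector y ⊆ T.sector (T.parent y) := by
  intro z
  refine T.parent_induction (P := fun z => z ∈ T.sector y → z ∈ T.sector (T.parent y)) ?_ ?_ z
  · intro h
    have := T.eq_of_mem_sector_of_level_le h (by simp)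
    rw [← this, parent_root]
    exact T.self_mem_sector _
  · intro z hz ih h
    by_cases hzp : z = T.parent y
    · rw [hzp]; exact T.self_mem_sector _
    · rw [T.mem_sector_iff_parent hzp]
      refine ⟨hz, ?_⟩
      by_cases hzy : z = y
      · rw [hzy]; exact T.self_mem_sector _
      · exact ih ((T.mem_sector_iff_parent hzy).1 h).2

theorem eq_of_mem_sector_of_mem_sector {y y' z : V} (h : z ∈ T.sector y) (h' : z ∈ T.sector y')
    (hl : T.level y = T.level y') : y = y' := by
  revert h h'
  refine T.parent_induction (P := fun z => z ∈ T.sector y → z ∈ T.sector y' → y = y') ?_ ?_ z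
  · intro h h'
    rw [← T.eq_of_mem_sector_of_level_le h (by simp), ← T.eq_of_mem_sector_of_level_le h' (by simp)]
  · intro z hz ih h h'
    by_cases hzy : z = y
    · subst hzy
      exact T.eq_of_mem_sector_of_level_le h' hl.le
    by_cases hzy' : z = y'
    · subst hzy'
      exact (T.eq_of_mem_sector_of_level_le h hl.ge).symm
    exact ih ((T.mem_sector_iff_parent hzy).1 h).2 ((T.mem_sector_iff_parent hzy').1 h').2

theorem mem_sector_iff_children {x z : V} :
    z ∈ T.sector x ↔ z = x ∨ ∃ y ∈ T.children x, z ∈ T.sector y := by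
  constructor
  · refine T.parent_induction
      (P := fun z => z ∈ T.sector x → z = x ∨ ∃ y ∈ T.children x, z ∈ T.sector y) ?_ ?_ z
    · intro h
      exact Or.inl (T.eq_of_mem_sector_of_level_le h (by simp))
    · intro z hz ih h
      by_cases hzx : z = x
      · exact Or.inl hzx
      refine Or.inr ?_
      rcases ih ((T.mem_sector_iff_parent hzx).1 h).2 with h1 | ⟨y, hy, h1⟩
      · exact ⟨z, T.mem_children.2 ⟨hz, h1⟩, T.self_mem_sector z⟩
      · refine ⟨y, hy, ?_⟩
        by_cases hzy : z = y
        · rw [hzy]; exact T.self_mem_sector _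
        · exact (T.mem_sector_iff_parent hzy).2 ⟨hz, h1⟩
  · rintro (rfl | ⟨y, hy, h⟩)
    · exact T.self_mem_sector _
    · rw [← (T.mem_children.1 hy).2]
      exact T.sector_subset_sector_parent y h

theorem self_notMem_sector_of_mem_children {x y : V} (hy : y ∈ T.children x) :
    x ∉ T.sector y := by
  intro h
  have h1 := T.level_le_of_mem_sector h
  have h2 := T.level_of_mem_children hy
  omega

/-- Functions on a sector split over its generating vertex and the sectors of the children. -/
theorem indicator_sector {M : Type*} [AddCommMonoid M] (f : V → M) (x z : V) :
    (T.sector x).indicator f z =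
      ({x} : Set V).indicator f z + ∑ y ∈ T.children x, (T.sector y).indicator f z := by
  by_cases hzx : z = x
  · subst hzx
    rw [Set.indicator_of_mem (T.self_mem_sector z), Set.indicator_of_mem (Set.mem_singleton z),
      Finset.sum_eq_zero, add_zero]
    intro y hy
    exact Set.indicator_of_notMem (T.self_notMem_sector_of_mem_children hy) f
  rw [Set.indicator_of_notMem (s := {x}) (by simpa using hzx), zero_add]
  by_cases hz : z ∈ T.sector x
  · rw [Set.indicator_of_mem hz]
    obtain ⟨y, hy, hzy⟩ := (T.mem_sector_iff_children.1 hz).resolve_left hzx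
    rw [Finset.sum_eq_single_of_mem y hy, Set.indicator_of_mem hzy]
    intro y' hy' hne
    refine Set.indicator_of_notMem (fun h => hne ?_) f
    refine T.eq_of_mem_sector_of_mem_sector h hzy ?_
    rw [T.level_of_mem_children hy, T.level_of_mem_children hy']
  · rw [Set.indicator_of_notMem hz, Finset.sum_eq_zero]
    intro y hy
    exact Set.indicator_of_notMem (fun h => hz (T.mem_sector_iff_children.2 (Or.inr ⟨y, hy, h⟩))) f

/-- The siblings of `y`, including `y` itself; the origin has none. -/
def siblings (y : V) : Finset V :=
  haveI := Classical.dec (y = T.root)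
  if y = T.root then ∅ else T.children (T.parent y)

theorem mem_siblings {y y' : V} :
    y' ∈ T.siblings y ↔ y ≠ T.root ∧ y' ≠ T.root ∧ T.parent y' = T.parent y := by
  unfold siblings
  split_ifs with h
  · simp [h]
  · simp [h, mem_children]

theorem mem_siblings_comm {y y' : V} : y' ∈ T.siblings y ↔ y ∈ T.siblings y' := by
  rw [mem_siblings, mem_siblings, eq_comm (a := T.parent y)]
  tauto

theorem level_of_mem_siblings {y y' : V} (h : y' ∈ T.siblings y) : T.level y' = T.level y := by
  obtain ⟨h1, h2, h3⟩ := T.mem_siblings.1 h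
  rw [T.level_parent h1, T.level_parent h2, h3]

theorem card_siblings_le (y : V) : (T.siblings y).card ≤ T.q (T.level (T.parent y)) := by
  unfold siblings
  split_ifs with h
  · simp
  · rw [card_children]

end RadialTree

/-! ### Hölder's inequality and the one-vertex Hardy inequality -/

theorem ENNReal.tsum_mul_le_Lp_mul_Lq {ι : Type*} (f g : ι → ℝ≥0∞) {p q : ℝ}
    (hpq : p.HolderConjugate q) :
    ∑' i, f i * g i ≤ (∑' i, f i ^ p) ^ (1 / p) * (∑' i, g i ^ q) ^ (1 / q) := by
  rw [ENNReal.tsum_eq_iSup_sum]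
  refine iSup_le fun s => (ENNReal.inner_le_Lp_mul_Lq s f g hpq).trans ?_
  have hp := hpq.pos
  have hq := hpq.symm.pos
  gcongr
  · exact ENNReal.sum_le_tsum s
  · exact ENNReal.sum_le_tsum s

/-- The inequality behind the dyadic Hardy inequality. The average `A` of a function over a sector
of mass `S` is composed of its value `f` at the vertex, with mass `σ`, and of the averages `a i`
over the sectors of the children, with masses `s i`. Passing from the children to the sector, the
quantity `∑ S A ^ p` drops by a multiple of `σ A ^ p`, up to the local term `σ f ^ p`. -/
theorem hardy_vertex {ι : Type*} (t : Finset ι) {p q : ℝ} (hpq : p.HolderConjugate q)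
    {σ f S A : ℝ} {s a : ι → ℝ} (hσ : 0 ≤ σ) (hf : 0 ≤ f) (hA : 0 ≤ A)
    (hs : ∀ i, 0 ≤ s i) (ha : ∀ i, 0 ≤ a i) (hS : S = σ + ∑ i ∈ t, s i)
    (hSA : S * A = σ * f + ∑ i ∈ t, s i * a i) :
    (2 * q)⁻¹ * (σ * A ^ p) + p⁻¹ * (S * A ^ p) ≤
      2 ^ (p - 1) * p⁻¹ * (σ * f ^ p) + p⁻¹ * ∑ i ∈ t, s i * a i ^ p := by
  have hp := hpq.pos
  have hq := hpq.symm.pos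
  have hinv : p⁻¹ + q⁻¹ = 1 := hpq.inv_add_inv_eq_one
  have hAq : (A ^ (p - 1)) ^ q = A ^ p := by
    rw [← Real.rpow_mul hA, hpq.sub_one_mul_conj]
  have hAp : A * A ^ (p - 1) = A ^ p := by
    rcases hA.eq_or_lt with h | h
    · rw [← h, Real.zero_rpow hp.ne', zero_mul]
    · rw [Real.rpow_sub_one h.ne']; field_simp
  have hB : 0 ≤ A ^ (p - 1) := Real.rpow_nonneg hA _
  have h1 : ∀ i, a i * A ^ (p - 1) ≤ a i ^ p / p + A ^ p / q := fun i => by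
    have := Real.young_inequality_of_nonneg (ha i) hB hpq
    rwa [hAq] at this
  -- The factor `2 ^ (1 / q)` is chosen so that half of the term `A ^ p / q` can be absorbed.
  have h2 : f * A ^ (p - 1) ≤ 2 ^ (p - 1) * p⁻¹ * f ^ p + (2 * q)⁻¹ * A ^ p := by
    have hc : (0 : ℝ) < 2 ^ q⁻¹ := Real.rpow_pos_of_pos two_pos _
    have := Real.young_inequality_of_nonneg (mul_nonneg hc.le hf)
      (mul_nonneg (inv_nonneg.2 hc.le) hB) hpq
    rw [Real.mul_rpow hc.le hf, Real.mul_rpow (inv_nonneg.2 hc.le) hB, hAq,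
      Real.inv_rpow hc.le, ← Real.rpow_mul two_pos.le, ← Real.rpow_mul two_pos.le,
      inv_mul_cancel₀ hq.ne', Real.rpow_one] at this
    have he : q⁻¹ * p = p - 1 := by
      have : q⁻¹ = 1 - p⁻¹ := by linarith
      rw [this]; field_simp
    rw [he] at this
    calc f * A ^ (p - 1) = 2 ^ q⁻¹ * f * ((2 ^ q⁻¹)⁻¹ * A ^ (p - 1)) := by field_simp
      _ ≤ _ := this
      _ = _ := by field_simp
  have h3 : S * A ^ p = σ * (f * A ^ (p - 1)) + ∑ i ∈ t, s i * (a i * A ^ (p - 1)) := by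
    rw [← hAp, ← mul_assoc, hSA, add_mul, Finset.sum_mul]
    simp only [mul_assoc]
  have h4 : ∑ i ∈ t, s i * (a i * A ^ (p - 1)) ≤
      p⁻¹ * (∑ i ∈ t, s i * a i ^ p) + q⁻¹ * ((S - σ) * A ^ p) := by
    rw [hS, add_sub_cancel_left, Finset.sum_mul, Finset.mul_sum, Finset.mul_sum,
      ← Finset.sum_add_distrib]
    refine Finset.sum_le_sum fun i _ => (mul_le_mul_of_nonneg_left (h1 i) (hs i)).trans_eq ?_
    ring
  have h5 := mul_le_mul_of_nonneg_left h2 hσ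
  have h6 : (2 * q)⁻¹ * (σ * A ^ p) = q⁻¹ * (σ * A ^ p) - σ * ((2 * q)⁻¹ * A ^ p) := by
    field_simp; ring
  have h7 : p⁻¹ * (S * A ^ p) = S * A ^ p - q⁻¹ * (S * A ^ p) := by
    linear_combination (S * A ^ p) * hinv
  rw [h6, h7]
  nlinarith [h3, h4, h5]

namespace RadialTree

variable {V : Type*} (T : RadialTree V)

/-! ### Sums over sectors -/

/-- The sum of a nonnegative function over the sector generated by `x`. -/
def sectorSum (f : V → ℝ≥0∞) (x : V) : ℝ≥0∞ := ∑' z, (T.sector x).indicator f z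

theorem sectorSum_eq (f : V → ℝ≥0∞) (x : V) :
    T.sectorSum f x = f x + ∑ y ∈ T.children x, T.sectorSum f y := by
  classical
  unfold sectorSum
  simp_rw [T.indicator_sector f x]
  rw [ENNReal.tsum_add, ← Summable.tsum_finsetSum (fun _ _ => ENNReal.summable)]
  congr 1
  rw [tsum_eq_single x, Set.indicator_of_mem (Set.mem_singleton x)]
  intro y hy
  exact Set.indicator_of_notMem (by simpa using hy) f

theorem sectorSum_root (f : V → ℝ≥0∞) : T.sectorSum f T.root = ∑' z, f z := by
  simp [sectorSum]

theorem sectorSum_le_tsum (f : V → ℝ≥0∞) (x : V) : T.sectorSum f x ≤ ∑' z, f z :=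
  ENNReal.tsum_le_tsum fun _ => Set.indicator_le_self _ _ _

theorem le_sectorSum (f : V → ℝ≥0∞) (x : V) : f x ≤ T.sectorSum f x := by
  rw [sectorSum_eq]; exact le_self_add

/-- A sum over vertices of sector sums can be carried out in the other order. -/
theorem tsum_mul_sectorSum (a f : V → ℝ≥0∞) :
    ∑' y, a y * T.sectorSum f y = ∑' z, (∑' y, (T.sector y).indicator (fun _ => a y) z) * f z := by
  simp_rw [sectorSum, ← ENNReal.tsum_mul_left, ← ENNReal.tsum_mul_right]
  rw [ENNReal.tsum_comm]
  refine tsum_congr fun z => tsum_congr fun y => ?_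
  by_cases hz : z ∈ T.sector y <;> simp [hz]

theorem sectorSum_mul_rpow_le {p q : ℝ} (hpq : p.HolderConjugate q) (h σ : V → ℝ≥0∞) (x : V) :
    T.sectorSum (fun z => h z * σ z) x ≤
      T.sectorSum (fun z => h z ^ p * σ z) x ^ (1 / p) * T.sectorSum σ x ^ (1 / q) := by
  have hp := hpq.pos
  have hq := hpq.symm.pos
  have hinv : p⁻¹ + q⁻¹ = 1 := hpq.inv_add_inv_eq_one
  have key := ENNReal.tsum_mul_le_Lp_mul_Lq
    (fun z => (T.sector x).indicator (fun z => h z * σ z ^ (1 / p)) z)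
    (fun z => (T.sector x).indicator (fun z => σ z ^ (1 / q)) z) hpq
  unfold sectorSum
  convert key using 4 with z z z
  · by_cases hz : z ∈ T.sector x
    · simp only [Set.indicator_of_mem hz]
      rw [mul_assoc, ← ENNReal.rpow_add_of_nonneg _ _ (by positivity) (by positivity)]
      simp [hinv]
    · simp [hz]
  · funext z
    by_cases hz : z ∈ T.sector x
    · simp only [Set.indicator_of_mem hz]
      rw [ENNReal.mul_rpow_of_nonneg _ _ hp.le, ← ENNReal.rpow_mul, one_div_mul_cancel hp.ne',
        ENNReal.rpow_one]
    · simp [hz, hp]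
  · funext z
    by_cases hz : z ∈ T.sector x
    · simp only [Set.indicator_of_mem hz]
      rw [← ENNReal.rpow_mul, one_div_mul_cancel hq.ne', ENNReal.rpow_one]
    · simp [hz, hq]

/-- The average of `h` over the sector generated by `x`, with respect to the weights `σ`. -/
def sectorAvg (σ h : V → ℝ≥0∞) (x : V) : ℝ≥0∞ :=
  T.sectorSum (fun z => h z * σ z) x / T.sectorSum σ x

theorem sectorSum_mul_sectorAvg {σ h : V → ℝ≥0∞} {x : V} (h0 : T.sectorSum σ x ≠ 0)
    (ht : T.sectorSum σ x ≠ ∞) :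
    T.sectorSum σ x * T.sectorAvg σ h x = T.sectorSum (fun z => h z * σ z) x :=
  ENNReal.mul_div_cancel h0 ht

theorem sectorSum_mul_sectorAvg_rpow_le {p q : ℝ} (hpq : p.HolderConjugate q) {σ h : V → ℝ≥0∞}
    {x : V} (h0 : T.sectorSum σ x ≠ 0) (ht : T.sectorSum σ x ≠ ∞) :
    T.sectorSum σ x * T.sectorAvg σ h x ^ p ≤ T.sectorSum (fun z => h z ^ p * σ z) x := by
  have hp := hpq.pos
  have hinv : p⁻¹ + q⁻¹ = 1 := hpq.inv_add_inv_eq_one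
  have h1 := T.sectorSum_mul_rpow_le hpq h σ x
  have h2 := ENNReal.rpow_le_rpow h1 hp.le
  rw [ENNReal.mul_rpow_of_nonneg _ _ hp.le, ← ENNReal.rpow_mul, one_div_mul_cancel hp.ne',
    ENNReal.rpow_one, ← ENNReal.rpow_mul] at h2
  have he : 1 / q * p = p - 1 := by
    have : q⁻¹ = 1 - p⁻¹ := by linarith
    rw [one_div, this]; field_simp
  rw [he] at h2
  unfold sectorAvg
  set S := T.sectorSum σ x
  rw [ENNReal.div_rpow_of_nonneg _ _ hp.le, ← mul_div_assoc,
    ENNReal.div_le_iff (by simp [h0, hp, ht]) (by simp [h0, hp, ht])]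
  calc S * T.sectorSum (fun z => h z * σ z) x ^ p
      ≤ S * (T.sectorSum (fun z => h z ^ p * σ z) x * S ^ (p - 1)) := by gcongr
    _ = T.sectorSum (fun z => h z ^ p * σ z) x * (S * S ^ (p - 1)) := by ring
    _ = T.sectorSum (fun z => h z ^ p * σ z) x * S ^ p := by
      congr 1
      conv_lhs => enter [1]; rw [← ENNReal.rpow_one S]
      rw [← ENNReal.rpow_add _ _ h0 ht]
      congr 1; ring

end RadialTree

/-! ### Hardy's inequality on the tree -/

theorem ENNReal.ofReal_mul_toReal_mul_rpow {c : ℝ} (hc : 0 ≤ c) {u v : ℝ≥0∞} (hu : u ≠ ∞)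
    (hv : v ≠ ∞) {p : ℝ} (hp : 0 ≤ p) :
    ENNReal.ofReal (c * (u.toReal * v.toReal ^ p)) = ENNReal.ofReal c * (u * v ^ p) := by
  rw [ENNReal.ofReal_mul hc, ENNReal.ofReal_mul ENNReal.toReal_nonneg, ENNReal.ofReal_toReal hu,
    ← ENNReal.ofReal_rpow_of_nonneg ENNReal.toReal_nonneg hp, ENNReal.ofReal_toReal hv]

/-- The constant of Hardy's inequality on the tree. -/
def hardyConst (p q : ℝ) : ℝ≥0∞ :=
  ENNReal.ofReal (2 * q) * (ENNReal.ofReal (2 ^ (p - 1) * p⁻¹) + ENNReal.ofReal p⁻¹)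

theorem hardyConst_ne_top (p q : ℝ) : hardyConst p q ≠ ∞ := by
  unfold hardyConst
  finiteness

namespace RadialTree

variable {V : Type*} (T : RadialTree V)

section Hardy

variable {σ h : V → ℝ≥0∞} {p q : ℝ}

theorem sectorSum_ne_zero (hσ : ∀ x, σ x ≠ 0) (x : V) : T.sectorSum σ x ≠ 0 := fun h0 =>
  hσ x (le_antisymm ((T.le_sectorSum σ x).trans h0.le) bot_le)

theorem sectorSum_ne_top (ht : ∑' x, σ x ≠ ∞) (x : V) : T.sectorSum σ x ≠ ∞ :=
  ne_top_of_le_ne_top ht (T.sectorSum_le_tsum σ x)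

theorem sectorAvg_ne_top (hpq : p.HolderConjugate q) (hσ : ∀ x, σ x ≠ 0) (ht : ∑' x, σ x ≠ ∞)
    (hh : ∑' x, h x ^ p * σ x ≠ ∞) (x : V) : T.sectorAvg σ h x ≠ ∞ := by
  have hp := hpq.pos
  have h1 := T.sectorSum_mul_sectorAvg_rpow_le hpq (h := h) (T.sectorSum_ne_zero hσ x)
    (T.sectorSum_ne_top ht x)
  intro hA
  rw [hA, ENNReal.top_rpow_of_pos hp, ENNReal.mul_top (T.sectorSum_ne_zero hσ x), top_le_iff] at h1
  exact T.sectorSum_ne_top hh x h1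

/-- The inequality `hardy_vertex` for the averages of `h` over the sectors of `x` and of its
children. -/
theorem hardy_step (hpq : p.HolderConjugate q) (hσ : ∀ x, σ x ≠ 0) (ht : ∑' x, σ x ≠ ∞)
    (hh : ∑' x, h x ^ p * σ x ≠ ∞) (x : V) :
    ENNReal.ofReal (2 * q)⁻¹ * (σ x * T.sectorAvg σ h x ^ p) +
        ENNReal.ofReal p⁻¹ * (T.sectorSum σ x * T.sectorAvg σ h x ^ p) ≤
      ENNReal.ofReal (2 ^ (p - 1) * p⁻¹) * (h x ^ p * σ x) +
        ENNReal.ofReal p⁻¹ *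
          ∑ y ∈ T.children x, T.sectorSum σ y * T.sectorAvg σ h y ^ p := by
  have hp := hpq.pos
  have hq := hpq.symm.pos
  have hA := T.sectorAvg_ne_top hpq hσ ht hh
  have hS := T.sectorSum_ne_top ht
  have hS0 := T.sectorSum_ne_zero hσ
  have hσt : ∀ x, σ x ≠ ∞ := fun x => ne_top_of_le_ne_top (hS x) (T.le_sectorSum σ x)
  have hht : h x ≠ ∞ := by
    intro hx
    refine hh (ENNReal.tsum_eq_top_of_eq_top ⟨x, ?_⟩)
    rw [hx, ENNReal.top_rpow_of_pos hp, ENNReal.top_mul (hσ x)]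
  have e1 : (T.sectorSum σ x).toReal = (σ x).toReal +
      ∑ y ∈ T.children x, (T.sectorSum σ y).toReal := by
    rw [← ENNReal.toReal_sum (fun y _ => hS y), ← ENNReal.toReal_add (hσt x)
      (by simpa using fun y _ => hS y), ← sectorSum_eq]
  have e2 : (T.sectorSum σ x).toReal * (T.sectorAvg σ h x).toReal = (σ x).toReal * (h x).toReal +
      ∑ y ∈ T.children x, (T.sectorSum σ y).toReal * (T.sectorAvg σ h y).toReal := by
    simp_rw [← ENNReal.toReal_mul]
    rw [← ENNReal.toReal_sum (fun y _ => ENNReal.mul_ne_top (hS y) (hA y)),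
      ← ENNReal.toReal_add (ENNReal.mul_ne_top (hσt x) hht)
      (by simpa using fun y _ => ENNReal.mul_ne_top (hS y) (hA y)),
      T.sectorSum_mul_sectorAvg (hS0 x) (hS x), sectorSum_eq, mul_comm (h x)]
    congr 2
    exact Finset.sum_congr rfl fun y _ => (T.sectorSum_mul_sectorAvg (hS0 y) (hS y)).symm
  have hr : ∀ c : ℝ, 0 ≤ c → ∀ u v : ℝ≥0∞, 0 ≤ c * (u.toReal * v.toReal ^ p) := fun c hc u v =>
    mul_nonneg hc (mul_nonneg ENNReal.toReal_nonneg (Real.rpow_nonneg ENNReal.toReal_nonneg _))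
  have h1 : 0 ≤ (2 * q)⁻¹ := by positivity
  have h2 : 0 ≤ p⁻¹ := by positivity
  have h3 : 0 ≤ 2 ^ (p - 1) * p⁻¹ := by positivity
  have key := ENNReal.ofReal_le_ofReal (hardy_vertex (T.children x) hpq
    (σ := (σ x).toReal) (f := (h x).toReal) (S := (T.sectorSum σ x).toReal)
    (A := (T.sectorAvg σ h x).toReal) (s := fun y => (T.sectorSum σ y).toReal)
    (a := fun y => (T.sectorAvg σ h y).toReal)
    ENNReal.toReal_nonneg ENNReal.toReal_nonneg ENNReal.toReal_nonneg
    (fun _ => ENNReal.toReal_nonneg) (fun _ => ENNReal.toReal_nonneg) e1 e2)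
  rw [Finset.mul_sum, ENNReal.ofReal_add (hr _ h1 _ _) (hr _ h2 _ _),
    ENNReal.ofReal_add (hr _ h3 _ _) (Finset.sum_nonneg fun _ _ => hr _ h2 _ _),
    ENNReal.ofReal_sum_of_nonneg (fun _ _ => hr _ h2 _ _),
    ENNReal.ofReal_mul_toReal_mul_rpow (by positivity) (hσt x) (hA x) hp.le,
    ENNReal.ofReal_mul_toReal_mul_rpow (by positivity) (hS x) (hA x) hp.le,
    ENNReal.ofReal_mul_toReal_mul_rpow (by positivity) (hσt x) hht hp.le] at key
  simp_rw [ENNReal.ofReal_mul_toReal_mul_rpow (inv_nonneg.2 hp.le) (hS _) (hA _) hp.le] at key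
  rwa [← Finset.mul_sum, mul_comm (σ x) (h x ^ p)] at key

/-- Iteration of `hardy_step` down to level `N`, where Jensen's inequality takes over. -/
theorem hardy_truncated (hpq : p.HolderConjugate q) (hσ : ∀ x, σ x ≠ 0) (ht : ∑' x, σ x ≠ ∞)
    (hh : ∑' x, h x ^ p * σ x ≠ ∞) (N n : ℕ) (x : V) (hN : N ≤ T.level x + n) :
    ENNReal.ofReal (2 * q)⁻¹ *
          T.sectorSum (fun z => if T.level z < N then σ z * T.sectorAvg σ h z ^ p else 0) x +
        ENNReal.ofReal p⁻¹ * (T.sectorSum σ x * T.sectorAvg σ h x ^ p) ≤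
      (ENNReal.ofReal (2 ^ (p - 1) * p⁻¹) + ENNReal.ofReal p⁻¹) *
        T.sectorSum (fun z => h z ^ p * σ z) x := by
  set F : V → ℝ≥0∞ := fun z => if T.level z < N then σ z * T.sectorAvg σ h z ^ p else 0 with hF
  induction n generalizing x with
  | zero =>
    have h0 : T.sectorSum F x = 0 := by
      refine ENNReal.tsum_eq_zero.2 fun z => ?_
      by_cases hz : z ∈ T.sector x
      · have := T.level_le_of_mem_sector hz
        rw [Set.indicator_of_mem hz, hF]
        exact if_neg (by omega)
      · simp [hz]
    rw [h0, mul_zero, zero_add, add_mul]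
    refine le_add_left ?_
    gcongr
    exact T.sectorSum_mul_sectorAvg_rpow_le hpq (T.sectorSum_ne_zero hσ x)
      (T.sectorSum_ne_top ht x)
  | succ n ih =>
    set c₁ := ENNReal.ofReal (2 * q)⁻¹
    set c₂ := ENNReal.ofReal (2 ^ (p - 1) * p⁻¹)
    set c₃ := ENNReal.ofReal p⁻¹
    have hFx : F x ≤ σ x * T.sectorAvg σ h x ^ p := by
      rw [hF]; dsimp only
      split_ifs
      · exact le_rfl
      · exact bot_le
    calc c₁ * T.sectorSum F x + c₃ * (T.sectorSum σ x * T.sectorAvg σ h x ^ p)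
        = c₁ * F x + c₃ * (T.sectorSum σ x * T.sectorAvg σ h x ^ p) +
            c₁ * ∑ y ∈ T.children x, T.sectorSum F y := by rw [T.sectorSum_eq F]; ring
      _ ≤ c₁ * (σ x * T.sectorAvg σ h x ^ p) +
            c₃ * (T.sectorSum σ x * T.sectorAvg σ h x ^ p) +
            c₁ * ∑ y ∈ T.children x, T.sectorSum F y := by gcongr
      _ ≤ c₂ * (h x ^ p * σ x) + c₃ * ∑ y ∈ T.children x, T.sectorSum σ y *
            T.sectorAvg σ h y ^ p + c₁ * ∑ y ∈ T.children x, T.sectorSum F y :=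
          add_le_add_left (T.hardy_step hpq hσ ht hh x) _
      _ = c₂ * (h x ^ p * σ x) + ∑ y ∈ T.children x, (c₁ * T.sectorSum F y +
            c₃ * (T.sectorSum σ y * T.sectorAvg σ h y ^ p)) := by
          rw [Finset.sum_add_distrib, Finset.mul_sum, Finset.mul_sum]; ring
      _ ≤ (c₂ + c₃) * (h x ^ p * σ x) +
            ∑ y ∈ T.children x, (c₂ + c₃) * T.sectorSum (fun z => h z ^ p * σ z) y := by
          gcongr with y hy
          · exact le_self_add
          · exact ih y (by rw [T.level_of_mem_children hy]; omega)
      _ = _ := by rw [T.sectorSum_eq, ← Finset.mul_sum, mul_add]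

/-- Hardy's inequality on the tree: averaging over sectors is bounded on `L^p(σ)`, with a constant
that does not depend on `σ`. -/
theorem hardy (hpq : p.HolderConjugate q) (hσ : ∀ x, σ x ≠ 0) (ht : ∑' x, σ x ≠ ∞) :
    ∑' x, σ x * T.sectorAvg σ h x ^ p ≤ hardyConst p q * ∑' x, h x ^ p * σ x := by
  have hp := hpq.pos
  have hq := hpq.symm.pos
  by_cases hh : ∑' x, h x ^ p * σ x = ∞
  · rw [hh, ENNReal.mul_top]
    · exact le_top
    · unfold hardyConst
      refine mul_ne_zero (ENNReal.ofReal_pos.2 (by positivity)).ne' ?_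
      rw [ne_eq, add_eq_zero, not_and_or]
      exact Or.inr (ENNReal.ofReal_pos.2 (by positivity)).ne'
  rw [ENNReal.tsum_eq_iSup_sum]
  refine iSup_le fun s => ?_
  have h1 := le_self_add.trans
    (T.hardy_truncated hpq hσ ht hh (s.sup T.level + 1) (s.sup T.level + 1) T.root le_add_self)
  rw [sectorSum_root, sectorSum_root] at h1
  have h2 : ∑ x ∈ s, σ x * T.sectorAvg σ h x ^ p ≤
      ∑' z, if T.level z < s.sup T.level + 1 then σ z * T.sectorAvg σ h z ^ p else 0 := by
    refine le_trans (Finset.sum_le_sum fun x hx => ?_) (ENNReal.sum_le_tsum s)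
    rw [if_pos (Nat.lt_succ_of_le (Finset.le_sup (f := T.level) hx))]
  refine h2.trans ?_
  have hc : ENNReal.ofReal (2 * q) * ENNReal.ofReal (2 * q)⁻¹ = 1 := by
    rw [← ENNReal.ofReal_mul (by positivity), mul_inv_cancel₀ (by positivity), ENNReal.ofReal_one]
  unfold hardyConst
  rw [mul_assoc]
  calc ∑' z, (if T.level z < s.sup T.level + 1 then σ z * T.sectorAvg σ h z ^ p else 0)
      = ENNReal.ofReal (2 * q) * (ENNReal.ofReal (2 * q)⁻¹ *
        ∑' z, if T.level z < s.sup T.level + 1 then σ z * T.sectorAvg σ h z ^ p else 0) := by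
        rw [← mul_assoc, hc, one_mul]
    _ ≤ _ := by gcongr

/-- The Carleson embedding for weights whose sector sums are controlled by the value at the
generating vertex. -/
theorem carleson_embedding (hpq : p.HolderConjugate q) (hσ : ∀ x, σ x ≠ 0) (ht : ∑' x, σ x ≠ ∞)
    {K : ℝ≥0∞} (hK : ∀ x, T.sectorSum σ x ≤ K * σ x) :
    ∑' x, T.sectorSum σ x * T.sectorAvg σ h x ^ p ≤
      K * hardyConst p q * ∑' x, h x ^ p * σ x := by
  calc ∑' x, T.sectorSum σ x * T.sectorAvg σ h x ^ p
      ≤ ∑' x, K * (σ x * T.sectorAvg σ h x ^ p) := ENNReal.tsum_le_tsum fun x => by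
        rw [← mul_assoc]; gcongr; exact hK x
    _ = K * ∑' x, σ x * T.sectorAvg σ h x ^ p := ENNReal.tsum_mul_left
    _ ≤ K * (hardyConst p q * ∑' x, h x ^ p * σ x) := by
        gcongr; exact T.hardy hpq hσ ht
    _ = _ := by ring

end Hardy

/-! ### Positive dyadic operators between weighted spaces -/

/-- Duality between `L^p(b)` and `L^q(b)`. -/
theorem _root_.ENNReal.Lp_le_of_forall_tsum_mul_le {b Φ : V → ℝ≥0∞} {p q : ℝ}
    (hpq : p.HolderConjugate q)
    (hb0 : ∀ z, b z ≠ 0) (hbt : ∀ z, b z ≠ ∞) {N : ℝ≥0∞} (hN : N ≠ ∞)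
    (hΦ : ∀ g : V → ℝ≥0∞, ∑' z, Φ z * (g z * b z) ≤ N * (∑' z, g z ^ q * b z) ^ (1 / q)) :
    (∑' z, Φ z ^ p * b z) ^ (1 / p) ≤ N := by
  classical
  have hp := hpq.pos
  have hq := hpq.symm.pos
  have hinv : p⁻¹ + q⁻¹ = 1 := hpq.inv_add_inv_eq_one
  -- Testing against the indicator of a vertex shows that `Φ` is finite.
  have hfin : ∀ z, Φ z ≠ ∞ := by
    intro z hz
    have h1 := hΦ (fun y => if y = z then 1 else 0)
    rw [tsum_eq_single z (fun y hy => by simp [hy]), tsum_eq_single z (fun y hy => by simp [hy, hq]),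
      hz, if_pos rfl, one_mul, ENNReal.top_mul (hb0 z), ENNReal.one_rpow, one_mul, top_le_iff] at h1
    exact ENNReal.mul_ne_top hN (ENNReal.rpow_ne_top_of_nonneg (by positivity) (hbt z)) h1
  -- Testing against `Φ ^ (p - 1)` on a finite set keeps the sum finite, so that one can divide.
  have key : ∀ s : Finset V, ∑ z ∈ s, Φ z ^ p * b z ≤ N ^ p := by
    intro s
    set X := ∑ z ∈ s, Φ z ^ p * b z with hX
    have hXt : X ≠ ∞ := by
      rw [hX]
      refine (ENNReal.sum_lt_top.2 fun z _ => ?_).ne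
      exact (ENNReal.mul_ne_top (ENNReal.rpow_ne_top_of_nonneg hp.le (hfin z)) (hbt z)).lt_top
    have h1 := hΦ (fun z => if z ∈ s then Φ z ^ (p - 1) else 0)
    have e1 : ∑' z, Φ z * ((if z ∈ s then Φ z ^ (p - 1) else 0) * b z) = X := by
      rw [tsum_eq_sum (s := s) (fun z hz => by simp [hz])]
      refine Finset.sum_congr rfl fun z hz => ?_
      rw [if_pos hz, ← mul_assoc]
      congr 1
      conv_lhs => enter [1]; rw [← ENNReal.rpow_one (Φ z)]
      rw [← ENNReal.rpow_add_of_nonneg _ _ zero_le_one hpq.sub_one_pos.le]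
      congr 1; ring
    have e2 : ∑' z, (if z ∈ s then Φ z ^ (p - 1) else 0) ^ q * b z = X := by
      rw [tsum_eq_sum (s := s) (fun z hz => by simp [hz, hq])]
      refine Finset.sum_congr rfl fun z hz => ?_
      rw [if_pos hz, ← ENNReal.rpow_mul, hpq.sub_one_mul_conj]
    rw [e1, e2] at h1
    rcases eq_or_ne X 0 with h0 | h0
    · rw [h0]; exact bot_le
    have h2 : X ^ (1 / p) ≤ N := by
      have e3 : X = X ^ (1 / p) * X ^ (1 / q) := by
        rw [← ENNReal.rpow_add _ _ h0 hXt, one_div, one_div, hinv, ENNReal.rpow_one]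
      have hne : X ^ (1 / q) ≠ 0 := by simp [h0, hXt]
      have hnt : X ^ (1 / q) ≠ ∞ := ENNReal.rpow_ne_top_of_nonneg (by positivity) hXt
      exact (ENNReal.mul_le_mul_iff_left hne hnt).1 (e3.symm.le.trans h1)
    have h3 := ENNReal.rpow_le_rpow h2 hp.le
    rwa [← ENNReal.rpow_mul, one_div_mul_cancel hp.ne', ENNReal.rpow_one] at h3
  have h4 : ∑' z, Φ z ^ p * b z ≤ N ^ p := by
    rw [ENNReal.tsum_eq_iSup_sum]; exact iSup_le key
  have h5 := ENNReal.rpow_le_rpow h4 (one_div_nonneg.2 hp.le)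
  rwa [← ENNReal.rpow_mul, mul_one_div_cancel hp.ne', ENNReal.rpow_one] at h5

section Bilinear

variable {a b m : V → ℝ≥0∞} {c : V → V → ℝ≥0∞} {p q : ℝ} {D : ℝ≥0∞}

/-- The two-weight product condition, in the form in which it enters the bilinear estimate. -/
theorem _root_.ENNReal.mul_div_le_of_test (hpq : p.HolderConjugate q) {u v m D : ℝ≥0∞} (hm0 : m ≠ 0)
    (hmt : m ≠ ∞) (hD : u / m * (v / m) ^ (p / q) ≤ D) :
    u * v / m ≤ D ^ (1 / p) * (v ^ (1 / p) * u ^ (1 / q)) := by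
  have hp := hpq.pos
  have hq := hpq.symm.pos
  have hinv : p⁻¹ + q⁻¹ = 1 := hpq.inv_add_inv_eq_one
  have h1 := ENNReal.rpow_le_rpow hD (one_div_nonneg.2 hp.le)
  rw [ENNReal.mul_rpow_of_nonneg _ _ (by positivity), ← ENNReal.rpow_mul] at h1
  have he : p / q * (1 / p) = 1 / q := by field_simp
  have split : ∀ t : ℝ≥0∞, t ^ (1 / p) * t ^ (1 / q) = t := fun t => by
    rw [← ENNReal.rpow_add_of_nonneg _ _ (by positivity) (by positivity), one_div, one_div, hinv,
      ENNReal.rpow_one]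
  rw [he, ENNReal.div_rpow_of_nonneg _ _ (by positivity),
    ENNReal.div_rpow_of_nonneg _ _ (by positivity)] at h1
  calc u * v / m = (u ^ (1 / p) * u ^ (1 / q)) * (v ^ (1 / p) * v ^ (1 / q)) /
        (m ^ (1 / p) * m ^ (1 / q)) := by rw [split, split, split]
    _ = (u ^ (1 / p) / m ^ (1 / p) * (v ^ (1 / q) / m ^ (1 / q))) *
          (v ^ (1 / p) * u ^ (1 / q)) := by
        simp only [div_eq_mul_inv]
        rw [ENNReal.mul_inv (Or.inl (by simp [hm0, hmt])) (Or.inr (by simp [hm0, hmt]))]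
        ring
    _ ≤ _ := by gcongr

theorem bilinear_le (hpq : p.HolderConjugate q)
    (ha0 : ∀ x, a x ≠ 0) (hat : ∑' x, a x ≠ ∞) (hb0 : ∀ x, b x ≠ 0) (hbt : ∑' x, b x ≠ ∞)
    {Ka Kb : ℝ≥0∞} (hKa : ∀ x, T.sectorSum a x ≤ Ka * a x) (hKb : ∀ x, T.sectorSum b x ≤ Kb * b x)
    (hc : ∀ y, ∑' y', c y y' ≤ 2) (hc' : ∀ y', ∑' y, c y y' ≤ 2)
    (hm0 : ∀ y, m y ≠ 0) (hmt : ∀ y, m y ≠ ∞)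
    (hD : ∀ y y', c y y' ≠ 0 →
      T.sectorSum b y / m y' * (T.sectorSum a y' / m y') ^ (p / q) ≤ D)
    (g h : V → ℝ≥0∞) :
    ∑' y, (∑' y', c y y' / m y' * T.sectorSum (fun z => h z * a z) y') *
        T.sectorSum (fun z => g z * b z) y ≤
      D ^ (1 / p) * (2 * (Ka * hardyConst p q * ∑' z, h z ^ p * a z)) ^ (1 / p) *
        (2 * (Kb * hardyConst q p * ∑' z, g z ^ q * b z)) ^ (1 / q) := by
  have hp := hpq.pos
  have hq := hpq.symm.pos
  have hinv : p⁻¹ + q⁻¹ = 1 := hpq.inv_add_inv_eq_one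
  set A := T.sectorAvg a h
  set B := T.sectorAvg b g
  set Sa := T.sectorSum a
  set Sb := T.sectorSum b
  have hterm : ∀ y y', c y y' / m y' * T.sectorSum (fun z => h z * a z) y' *
      T.sectorSum (fun z => g z * b z) y ≤ D ^ (1 / p) *
      ((c y y' ^ (1 / p) * (Sa y' ^ (1 / p) * A y')) *
        (c y y' ^ (1 / q) * (Sb y ^ (1 / q) * B y))) := by
    intro y y'
    by_cases h0 : c y y' = 0
    · simp [h0]
    rw [← T.sectorSum_mul_sectorAvg (T.sectorSum_ne_zero ha0 y') (T.sectorSum_ne_top hat y'),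
      ← T.sectorSum_mul_sectorAvg (T.sectorSum_ne_zero hb0 y) (T.sectorSum_ne_top hbt y)]
    have hcs : c y y' ^ (1 / p) * c y y' ^ (1 / q) = c y y' := by
      rw [← ENNReal.rpow_add_of_nonneg _ _ (by positivity) (by positivity), one_div, one_div, hinv,
        ENNReal.rpow_one]
    calc c y y' / m y' * (Sa y' * A y') * (Sb y * B y)
        = c y y' * (A y' * B y) * (Sb y * Sa y' / m y') := by simp only [div_eq_mul_inv]; ring
      _ ≤ c y y' * (A y' * B y) * (D ^ (1 / p) * (Sa y' ^ (1 / p) * Sb y ^ (1 / q))) := by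
          gcongr
          exact ENNReal.mul_div_le_of_test hpq (hm0 y') (hmt y') (hD y y' h0)
      _ = _ := by conv_lhs => rw [← hcs]
                  ring
  have hA : ∑' i : V × V, (c i.1 i.2 ^ (1 / p) * (Sa i.2 ^ (1 / p) * A i.2)) ^ p ≤
      2 * (Ka * hardyConst p q * ∑' z, h z ^ p * a z) := by
    calc ∑' i : V × V, (c i.1 i.2 ^ (1 / p) * (Sa i.2 ^ (1 / p) * A i.2)) ^ p
        = ∑' i : V × V, c i.1 i.2 * (Sa i.2 * A i.2 ^ p) := by
          refine tsum_congr fun i => ?_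
          simp only [ENNReal.mul_rpow_of_nonneg _ _ hp.le, ← ENNReal.rpow_mul,
            one_div_mul_cancel hp.ne', ENNReal.rpow_one]
      _ = ∑' y', ∑' y, c y y' * (Sa y' * A y' ^ p) := by
          rw [ENNReal.tsum_prod (f := fun y y' => c y y' * (Sa y' * A y' ^ p)), ENNReal.tsum_comm]
      _ ≤ ∑' y', 2 * (Sa y' * A y' ^ p) := ENNReal.tsum_le_tsum fun y' => by
          rw [ENNReal.tsum_mul_right]; gcongr; exact hc' y'
      _ = 2 * ∑' y', Sa y' * A y' ^ p := ENNReal.tsum_mul_left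
      _ ≤ _ := by gcongr; exact T.carleson_embedding hpq ha0 hat hKa
  have hB : ∑' i : V × V, (c i.1 i.2 ^ (1 / q) * (Sb i.1 ^ (1 / q) * B i.1)) ^ q ≤
      2 * (Kb * hardyConst q p * ∑' z, g z ^ q * b z) := by
    calc ∑' i : V × V, (c i.1 i.2 ^ (1 / q) * (Sb i.1 ^ (1 / q) * B i.1)) ^ q
        = ∑' i : V × V, c i.1 i.2 * (Sb i.1 * B i.1 ^ q) := by
          refine tsum_congr fun i => ?_
          simp only [ENNReal.mul_rpow_of_nonneg _ _ hq.le, ← ENNReal.rpow_mul,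
            one_div_mul_cancel hq.ne', ENNReal.rpow_one]
      _ = ∑' y, ∑' y', c y y' * (Sb y * B y ^ q) := by
          rw [ENNReal.tsum_prod (f := fun y y' => c y y' * (Sb y * B y ^ q))]
      _ ≤ ∑' y, 2 * (Sb y * B y ^ q) := ENNReal.tsum_le_tsum fun y => by
          rw [ENNReal.tsum_mul_right]; gcongr; exact hc y
      _ = 2 * ∑' y, Sb y * B y ^ q := ENNReal.tsum_mul_left
      _ ≤ _ := by gcongr; exact T.carleson_embedding hpq.symm hb0 hbt hKb
  calc ∑' y, (∑' y', c y y' / m y' * T.sectorSum (fun z => h z * a z) y') *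
        T.sectorSum (fun z => g z * b z) y
      ≤ ∑' y, ∑' y', D ^ (1 / p) * ((c y y' ^ (1 / p) * (Sa y' ^ (1 / p) * A y')) *
        (c y y' ^ (1 / q) * (Sb y ^ (1 / q) * B y))) := ENNReal.tsum_le_tsum fun y => by
          rw [← ENNReal.tsum_mul_right]
          exact ENNReal.tsum_le_tsum fun y' => hterm y y'
    _ = D ^ (1 / p) * ∑' i : V × V, (c i.1 i.2 ^ (1 / p) * (Sa i.2 ^ (1 / p) * A i.2)) *
        (c i.1 i.2 ^ (1 / q) * (Sb i.1 ^ (1 / q) * B i.1)) := by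
          rw [ENNReal.tsum_prod (f := fun y y' => (c y y' ^ (1 / p) * (Sa y' ^ (1 / p) * A y')) *
            (c y y' ^ (1 / q) * (Sb y ^ (1 / q) * B y)))]
          simp_rw [ENNReal.tsum_mul_left]
    _ ≤ D ^ (1 / p) * ((2 * (Ka * hardyConst p q * ∑' z, h z ^ p * a z)) ^ (1 / p) *
        (2 * (Kb * hardyConst q p * ∑' z, g z ^ q * b z)) ^ (1 / q)) := by
          gcongr
          refine (ENNReal.tsum_mul_le_Lp_mul_Lq _ _ hpq).trans ?_
          gcongr
    _ = _ := by ring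

/-- The positive operator which sends `f` to `∑ c(y, y') ⟨f⟩ 1_{S_y}`, where the averages run over
the sectors of `y'`. -/
def dyadicOperator (c : V → V → ℝ≥0∞) (m f : V → ℝ≥0∞) (z : V) : ℝ≥0∞ :=
  ∑' y, (T.sector y).indicator (fun _ => ∑' y', c y y' / m y' * T.sectorSum f y') z

theorem dyadicOperator_le (hpq : p.HolderConjugate q)
    (ha0 : ∀ x, a x ≠ 0) (hat : ∑' x, a x ≠ ∞) (hb0 : ∀ x, b x ≠ 0) (hbt : ∑' x, b x ≠ ∞)
    {Ka Kb : ℝ≥0∞} (hKa : ∀ x, T.sectorSum a x ≤ Ka * a x) (hKb : ∀ x, T.sectorSum b x ≤ Kb * b x)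
    (hKat : Ka ≠ ∞) (hKbt : Kb ≠ ∞) (hDt : D ≠ ∞)
    (hc : ∀ y, ∑' y', c y y' ≤ 2) (hc' : ∀ y', ∑' y, c y y' ≤ 2)
    (hm0 : ∀ y, m y ≠ 0) (hmt : ∀ y, m y ≠ ∞)
    (hD : ∀ y y', c y y' ≠ 0 →
      T.sectorSum b y / m y' * (T.sectorSum a y' / m y') ^ (p / q) ≤ D)
    {h : V → ℝ≥0∞} (hh : ∑' z, h z ^ p * a z ≠ ∞) :
    (∑' z, T.dyadicOperator c m (fun z => h z * a z) z ^ p * b z) ^ (1 / p) ≤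
      D ^ (1 / p) * (2 * (Ka * hardyConst p q)) ^ (1 / p) *
        (2 * (Kb * hardyConst q p)) ^ (1 / q) * (∑' z, h z ^ p * a z) ^ (1 / p) := by
  have hp := hpq.pos
  have hq := hpq.symm.pos
  have hbt' : ∀ z, b z ≠ ∞ := fun z => ENNReal.ne_top_of_tsum_ne_top hbt z
  refine ENNReal.Lp_le_of_forall_tsum_mul_le hpq hb0 hbt' ?_ fun g => ?_
  · have h1 := hardyConst_ne_top p q
    have h2 := hardyConst_ne_top q p
    refine ENNReal.mul_ne_top (ENNReal.mul_ne_top (ENNReal.mul_ne_top ?_ ?_) ?_) ?_ <;>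
    refine ENNReal.rpow_ne_top_of_nonneg (by positivity) ?_ <;> finiteness
  · have h1 := T.bilinear_le hpq ha0 hat hb0 hbt hKa hKb hc hc' hm0 hmt hD g h
    rw [T.tsum_mul_sectorSum] at h1
    refine h1.trans_eq ?_
    rw [← mul_assoc, ← mul_assoc 2 (Kb * _),
      ENNReal.mul_rpow_of_nonneg _ (∑' z, h z ^ p * a z) (by positivity),
      ENNReal.mul_rpow_of_nonneg _ (∑' z, g z ^ q * b z) (by positivity)]
    ring

end Bilinear

/-! ### Generations of descendants -/

open Classical in
/-- The descendants of `x` at distance `n` from `x`. -/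
def descendants : ℕ → V → Finset V
  | 0, x => {x}
  | n + 1, x => (T.children x).biUnion (descendants n)

theorem mem_descendants {n : ℕ} {x z : V} :
    z ∈ T.descendants n x ↔ z ∈ T.sector x ∧ T.level z = T.level x + n := by
  induction n generalizing x with
  | zero =>
    simp only [descendants, Finset.mem_singleton, add_zero]
    exact ⟨fun h => h ▸ ⟨T.self_mem_sector z, rfl⟩,
      fun h => T.eq_of_mem_sector_of_level_le h.1 h.2.le⟩
  | succ n ih =>
    simp only [descendants, Finset.mem_biUnion, ih]
    rw [T.mem_sector_iff_children]
    constructor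
    · rintro ⟨y, hy, hz, hl⟩
      exact ⟨Or.inr ⟨y, hy, hz⟩, by rw [hl, T.level_of_mem_children hy]; omega⟩
    · rintro ⟨rfl | ⟨y, hy, hz⟩, hl⟩
      · omega
      · exact ⟨y, hy, hz, by rw [hl, T.level_of_mem_children hy]; omega⟩

theorem sum_descendants_succ {M : Type*} [AddCommMonoid M] (f : V → M) (n : ℕ) (x : V) :
    ∑ z ∈ T.descendants (n + 1) x, f z = ∑ y ∈ T.children x, ∑ z ∈ T.descendants n y, f z := by
  classical
  rw [descendants, Finset.sum_biUnion]
  intro y hy y' hy' hne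
  refine Finset.disjoint_left.2 fun z hz hz' => hne ?_
  refine T.eq_of_mem_sector_of_mem_sector (T.mem_descendants.1 hz).1 (T.mem_descendants.1 hz').1 ?_
  rw [T.level_of_mem_children hy, T.level_of_mem_children hy']

theorem card_descendants (n : ℕ) (x : V) :
    (T.descendants n x).card = ∏ l ∈ Finset.range n, T.q (T.level x + l) := by
  induction n generalizing x with
  | zero => simp [descendants]
  | succ n ih =>
    have h := T.sum_descendants_succ (fun _ => 1) n x
    simp only [Finset.sum_const, smul_eq_mul, mul_one] at h
    rw [h, Finset.prod_range_succ', add_zero, mul_comm, ← T.card_children x, ← smul_eq_mul,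
      ← Finset.sum_const]
    refine Finset.sum_congr rfl fun y hy => ?_
    rw [ih, T.level_of_mem_children hy]
    exact Finset.prod_congr rfl fun l _ => by congr 1; omega

theorem tsum_fiber_indicator {M : Type*} [AddCommMonoid M] [TopologicalSpace M] (f : V → M) (n : ℕ)
    (x : V) :
    ∑' z : (fun z => T.level z - T.level x) ⁻¹' {n}, (T.sector x).indicator f z =
      ∑ z ∈ T.descendants n x, f z := by
  have h : ∀ z : V, z ∈ T.descendants n x ↔
      z ∈ T.sector x ∧ z ∈ (fun z => T.level z - T.level x) ⁻¹' {n} := by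
    intro z
    rw [mem_descendants, Set.mem_preimage, Set.mem_singleton_iff]
    refine and_congr_right fun hz => ?_
    have := T.level_le_of_mem_sector hz
    omega
  rw [tsum_subtype (f := (T.sector x).indicator f), tsum_eq_sum (s := T.descendants n x)]
  · refine Finset.sum_congr rfl fun z hz => ?_
    rw [Set.indicator_of_mem ((h z).1 hz).2, Set.indicator_of_mem ((h z).1 hz).1]
  · intro z hz
    by_contra hne
    have h1 : z ∈ (fun z => T.level z - T.level x) ⁻¹' {n} := by
      by_contra hh
      exact hne (Set.indicator_of_notMem hh _)
    rw [Set.indicator_of_mem h1] at hne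
    exact hz ((h z).2 ⟨Set.mem_of_indicator_ne_zero hne, h1⟩)

theorem sectorSum_eq_tsum_descendants (f : V → ℝ≥0∞) (x : V) :
    T.sectorSum f x = ∑' n, ∑ z ∈ T.descendants n x, f z := by
  rw [sectorSum, ← ENNReal.tsum_fiberwise _ (fun z => T.level z - T.level x)]
  exact tsum_congr fun n => T.tsum_fiber_indicator f n x

theorem hasSum_descendants {f : V → ℝ} (hf : Summable f) (x : V) :
    HasSum (fun n => ∑ z ∈ T.descendants n x, f z) (∑' z, (T.sector x).indicator f z) := by
  have h := (hf.indicator (T.sector x)).hasSum.tsum_fiberwise (fun z => T.level z - T.level x)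
  simp only [tsum_fiber_indicator] at h
  exact h

/-! ### The mass of a sector -/

/-- The mass of a vertex, as an extended nonnegative number. -/
def emass (α : ℝ) (x : V) : ℝ≥0∞ := ENNReal.ofReal (T.mass α x)

theorem emass_ne_zero (α : ℝ) (x : V) : T.emass α x ≠ 0 :=
  (ENNReal.ofReal_pos.2 (T.mass_pos α x)).ne'

theorem emass_ne_top (α : ℝ) (x : V) : T.emass α x ≠ ∞ := ENNReal.ofReal_ne_top

/-- The mass of the sector generated by `x`. -/
def sectorMass (α : ℝ) (x : V) : ℝ≥0∞ := T.sectorSum (T.emass α) x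

theorem mass_of_mem_children (α : ℝ) {x y : V} (hy : y ∈ T.children x) :
    T.mass α y = T.mass α x * ((T.q (T.level x) : ℝ) ^ α)⁻¹ := by
  rw [mass, T.level_of_mem_children hy, Finset.prod_range_succ, mass]

theorem sum_emass_descendants (α : ℝ) {n : ℕ} {x y : V} (h : T.level x = T.level y) :
    ∑ z ∈ T.descendants n x, T.emass α z = ∑ z ∈ T.descendants n y, T.emass α z := by
  have hx : ∀ x z, z ∈ T.descendants n x → T.emass α z =
      ENNReal.ofReal (∏ ℓ ∈ Finset.range (T.level x + n), ((T.q ℓ : ℝ) ^ α)⁻¹) := by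
    intro x z hz
    rw [emass, mass, (T.mem_descendants.1 hz).2]
  rw [Finset.sum_congr rfl (hx x), Finset.sum_congr rfl (hx y), Finset.sum_const,
    Finset.sum_const, card_descendants, card_descendants, h]

theorem sectorMass_eq_of_level_eq (α : ℝ) {x y : V} (h : T.level x = T.level y) :
    T.sectorMass α x = T.sectorMass α y := by
  rw [sectorMass, sectorMass, sectorSum_eq_tsum_descendants, sectorSum_eq_tsum_descendants]
  exact tsum_congr fun n => T.sum_emass_descendants α h

theorem sum_mass_descendants_le {α : ℝ} (hα : 1 < α) (n : ℕ) (x : V) :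
    ∑ z ∈ T.descendants n x, T.mass α z ≤ T.mass α x * ((2 : ℝ) ^ (1 - α)) ^ n := by
  induction n generalizing x with
  | zero => simp [descendants]
  | succ n ih =>
    rw [sum_descendants_succ]
    have hq : (0 : ℝ) < T.q (T.level x) := T.q_pos _
    calc ∑ y ∈ T.children x, ∑ z ∈ T.descendants n y, T.mass α z
        ≤ ∑ y ∈ T.children x, T.mass α x * ((T.q (T.level x) : ℝ) ^ α)⁻¹ *
            ((2 : ℝ) ^ (1 - α)) ^ n := Finset.sum_le_sum fun y hy => by
          rw [← T.mass_of_mem_children α hy]; exact ih y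
      _ = T.mass α x * (T.q (T.level x) : ℝ) ^ (1 - α) * ((2 : ℝ) ^ (1 - α)) ^ n := by
          rw [Finset.sum_const, card_children, nsmul_eq_mul, Real.rpow_sub hq, Real.rpow_one]
          ring
      _ ≤ T.mass α x * (2 : ℝ) ^ (1 - α) * ((2 : ℝ) ^ (1 - α)) ^ n := by
          have h2 : (2 : ℝ) ≤ T.q (T.level x) := by exact_mod_cast T.two_le_q _
          have := Real.rpow_le_rpow_of_nonpos two_pos h2 (by linarith : 1 - α ≤ 0)
          have h3 := (T.mass_pos α x).le
          gcongr
      _ = _ := by ring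

/-- The ratio between the mass of a sector and the mass of its generating vertex is at most this
constant. -/
def doublingConst (α : ℝ) : ℝ≥0∞ := (1 - ENNReal.ofReal ((2 : ℝ) ^ (1 - α)))⁻¹

theorem doublingConst_ne_top {α : ℝ} (hα : 1 < α) : doublingConst α ≠ ∞ := by
  rw [doublingConst, ne_eq, ENNReal.inv_eq_top, tsub_eq_zero_iff_le, not_le,
    ENNReal.ofReal_lt_one]
  exact Real.rpow_lt_one_of_one_lt_of_neg one_lt_two (by linarith)

theorem sectorMass_le {α : ℝ} (hα : 1 < α) (x : V) :
    T.sectorMass α x ≤ doublingConst α * T.emass α x := by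
  rw [sectorMass, sectorSum_eq_tsum_descendants, doublingConst, ← ENNReal.tsum_geometric,
    ← ENNReal.tsum_mul_right]
  refine ENNReal.tsum_le_tsum fun n => ?_
  simp_rw [emass]
  rw [← ENNReal.ofReal_sum_of_nonneg (fun z _ => (T.mass_pos α z).le),
    ← ENNReal.ofReal_pow (by positivity), ← ENNReal.ofReal_mul (by positivity), mul_comm]
  exact ENNReal.ofReal_le_ofReal (T.sum_mass_descendants_le hα n x)

theorem sectorMass_ne_zero (α : ℝ) (x : V) : T.sectorMass α x ≠ 0 :=
  T.sectorSum_ne_zero (T.emass_ne_zero α) x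

theorem sectorMass_ne_top {α : ℝ} (hα : 1 < α) (x : V) : T.sectorMass α x ≠ ∞ :=
  ne_top_of_le_ne_top (ENNReal.mul_ne_top (doublingConst_ne_top hα) (T.emass_ne_top α x))
    (T.sectorMass_le hα x)

/-! ### Integrals as sums -/

section Measure

variable [MeasurableSpace V] [DiscreteMeasurableSpace V]

theorem lintegral_measure (α : ℝ) (f : V → ℝ≥0∞) :
    ∫⁻ x, f x ∂T.measure α = ∑' x, f x * T.emass α x := by
  rw [measure, lintegral_sum_measure]
  refine tsum_congr fun x => ?_
  rw [lintegral_smul_measure, lintegral_dirac' _ (Measurable.of_discrete), smul_eq_mul, mul_comm]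
  rfl

theorem setLIntegral_sector (α : ℝ) (f : V → ℝ≥0∞) (y : V) :
    ∫⁻ x in T.sector y, f x ∂T.measure α = T.sectorSum (fun x => f x * T.emass α x) y := by
  rw [← lintegral_indicator MeasurableSet.of_discrete, lintegral_measure, sectorSum]
  refine tsum_congr fun x => ?_
  by_cases hx : x ∈ T.sector y <;> simp [hx]

theorem measure_sector (α : ℝ) (y : V) : T.measure α (T.sector y) = T.sectorMass α y := by
  have := T.setLIntegral_sector α 1 y
  simpa [sectorMass] using this

theorem isFiniteMeasure_measure {α : ℝ} (hα : 1 < α) : IsFiniteMeasure (T.measure α) := by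
  refine ⟨?_⟩
  rw [← sector_root, measure_sector]
  exact (T.sectorMass_ne_top hα _).lt_top

theorem laverage_sector (α : ℝ) (f : V → ℝ≥0∞) (y : V) :
    ⨍⁻ x in T.sector y, f x ∂T.measure α =
      T.sectorSum (fun x => f x * T.emass α x) y / T.sectorMass α y := by
  rw [setLAverage_eq, setLIntegral_sector, measure_sector]

theorem laverage_singleton (α : ℝ) (f : V → ℝ≥0∞) (y : V) :
    ⨍⁻ x in {y}, f x ∂T.measure α = f y := by
  have h := T.measure_singleton α y
  have h0 := T.emass_ne_zero α y
  have ht := T.emass_ne_top α y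
  rw [setLAverage_eq, Measure.restrict_singleton, lintegral_smul_measure,
    lintegral_dirac' _ (Measurable.of_discrete), h, smul_eq_mul, mul_comm]
  exact ENNReal.mul_div_cancel_right h0 ht

end Measure

/-! ### The dyadic system -/

theorem children_nonempty (x : V) : (T.children x).Nonempty := by
  rw [← Finset.card_pos, card_children]
  have := T.two_le_q (T.level x)
  omega

theorem sector_ne_singleton (x y : V) : T.sector y ≠ {x} := by
  intro h
  obtain ⟨z, hz⟩ := T.children_nonempty y
  have h1 : y ∈ ({x} : Set V) := h ▸ T.self_mem_sector y
  have h2 : z ∈ ({x} : Set V) :=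
    h ▸ T.mem_sector_iff_children.2 (Or.inr ⟨z, hz, T.self_mem_sector z⟩)
  have h3 := T.level_of_mem_children hz
  rw [Set.mem_singleton_iff.1 h1, Set.mem_singleton_iff.1 h2] at h3
  omega

theorem sector_injective : Function.Injective T.sector := by
  intro x y h
  have h1 : x ∈ T.sector y := h ▸ T.self_mem_sector x
  have h2 : y ∈ T.sector x := h ▸ T.self_mem_sector y
  exact T.eq_of_mem_sector_of_level_le h1 (T.level_le_of_mem_sector h2)

theorem sector_mem_partition {y : V} {k : ℕ} : T.sector y ∈ T.partition k ↔ T.level y = k := by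
  constructor
  · rintro (⟨x, -, h⟩ | ⟨x, hx, h⟩)
    · exact absurd h (T.sector_ne_singleton x y)
    · rwa [T.sector_injective h]
  · exact fun h => Or.inr ⟨y, h, rfl⟩

theorem singleton_mem_partition {x : V} {k : ℕ} : {x} ∈ T.partition k ↔ T.level x < k := by
  constructor
  · rintro (⟨y, hy, h⟩ | ⟨y, -, h⟩)
    · rwa [Set.singleton_injective h]
    · exact absurd h.symm (T.sector_ne_singleton x y)
  · exact fun h => Or.inl ⟨x, h, rfl⟩

theorem isParent_sector {x y : V} (hy : y ∈ T.children x) :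
    T.IsParent (T.sector x) (T.sector y) := by
  refine ⟨T.level x, ⟨?_, ?_⟩, T.sector_mem_partition.2 rfl, ?_⟩
  · exact T.sector_mem_partition.2 (T.level_of_mem_children hy)
  · intro j hj
    rw [← T.sector_mem_partition.1 hj, T.level_of_mem_children hy]
  · rw [← (T.mem_children.1 hy).2]
    exact T.sector_subset_sector_parent y

theorem isParent_singleton (x : V) : T.IsParent (T.sector x) {x} := by
  refine ⟨T.level x, ⟨?_, ?_⟩, T.sector_mem_partition.2 rfl, ?_⟩
  · exact T.singleton_mem_partition.2 (Nat.lt_succ_self _)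
  · intro j hj
    exact T.singleton_mem_partition.1 hj
  · exact Set.singleton_subset_iff.2 (T.self_mem_sector x)

theorem dyadic_cases {Q : Set V} (hQ : Q ∈ T.dyadic) :
    (∃ x, Q = {x}) ∨ ∃ y, Q = T.sector y := by
  obtain ⟨k, ⟨x, -, h⟩ | ⟨y, -, h⟩⟩ := hQ
  · exact Or.inl ⟨x, h⟩
  · exact Or.inr ⟨y, h⟩

theorem sector_mem_dyadic (y : V) : T.sector y ∈ T.dyadic := ⟨_, T.sector_mem_partition.2 rfl⟩

theorem isSibling_of_mem_siblings {y y' : V} (h : y' ∈ T.siblings y) :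
    T.IsSibling (T.sector y) (T.sector y') := by
  obtain ⟨h1, h2, h3⟩ := T.mem_siblings.1 h
  exact ⟨_, T.isParent_sector (T.mem_children_parent h1),
    T.isParent_sector (T.mem_children.2 ⟨h2, h3⟩)⟩

/-! ### Weights -/

section Weights

variable {α p : ℝ} {w : V → ℝ}

/-- The point masses of the measure `w dμ`. -/
def weightMass (α : ℝ) (w : V → ℝ) (x : V) : ℝ≥0∞ := ENNReal.ofReal (w x) * T.emass α x

/-- The point masses of the measure `w^{-p'/p} dμ`. -/
def dualMass (α p : ℝ) (w : V → ℝ) (x : V) : ℝ≥0∞ :=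
  ENNReal.ofReal (w x ^ (-(p.conjExponent / p))) * T.emass α x

theorem weightMass_ne_zero (hw : ∀ x, 0 < w x) (x : V) : T.weightMass α w x ≠ 0 :=
  mul_ne_zero (ENNReal.ofReal_pos.2 (hw x)).ne' (T.emass_ne_zero α x)

theorem dualMass_ne_zero (hw : ∀ x, 0 < w x) (x : V) : T.dualMass α p w x ≠ 0 :=
  mul_ne_zero (ENNReal.ofReal_pos.2 (Real.rpow_pos_of_pos (hw x) _)).ne' (T.emass_ne_zero α x)

theorem ofReal_weight_mul_dual (hp : 1 < p) (hw : ∀ x, 0 < w x) (x : V) :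
    ENNReal.ofReal (w x ^ (-(p.conjExponent / p))) ^ (p / p.conjExponent) *
      ENNReal.ofReal (w x) = 1 := by
  have hpq := Real.HolderConjugate.conjExponent hp
  have hq0 := hpq.symm.pos
  have hp0 := hpq.pos
  rw [ENNReal.ofReal_rpow_of_pos (Real.rpow_pos_of_pos (hw x) _), ← Real.rpow_mul (hw x).le,
    ← ENNReal.ofReal_mul (by have := hw x; positivity)]
  have : -(p.conjExponent / p) * (p / p.conjExponent) = -1 := by field_simp
  rw [this, Real.rpow_neg_one, inv_mul_cancel₀ (hw x).ne', ENNReal.ofReal_one]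

/-- For a weight with constant `B`, the averages over a sector are controlled by the values at the
generating vertex. -/
theorem _root_.ENNReal.le_of_test {u v s t C B : ℝ≥0∞} {r : ℝ} (hr : 0 < r)
    (hB : u * v ^ r ≤ B) (hts : t ^ r * s = 1) (hu : s ≤ C * u) (hv : t ≤ C * v) :
    u ≤ C ^ r * B * s ∧ v ≤ (C * B) ^ r⁻¹ * t := by
  constructor
  · calc u = u * t ^ r * s := by rw [mul_assoc, hts, mul_one]
      _ ≤ u * (C * v) ^ r * s := by gcongr
      _ = C ^ r * (u * v ^ r) * s := by rw [ENNReal.mul_rpow_of_nonneg _ _ hr.le]; ring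
      _ ≤ _ := by gcongr
  · have h1 : v ^ r ≤ C * B * t ^ r := by
      calc v ^ r = v ^ r * s * t ^ r := by rw [mul_assoc, mul_comm s, hts, mul_one]
        _ ≤ v ^ r * (C * u) * t ^ r := by gcongr
        _ = C * (u * v ^ r) * t ^ r := by ring
        _ ≤ _ := by gcongr
    have h2 := ENNReal.rpow_le_rpow h1 (inv_nonneg.2 hr.le)
    rwa [ENNReal.mul_rpow_of_nonneg _ _ (inv_nonneg.2 hr.le), ← ENNReal.rpow_mul,
      ← ENNReal.rpow_mul, mul_inv_cancel₀ hr.ne', ENNReal.rpow_one, ENNReal.rpow_one] at h2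

variable [MeasurableSpace V]

theorem testQuantity_le_siblingWeightConst {Q R : Set V} (h : T.IsSibling Q R) :
    T.testQuantity α p w Q R ≤ T.siblingWeightConst α p w :=
  le_iSup₂_of_le Q R (le_iSup_of_le h le_rfl)

theorem testQuantity_le_weightConst (y : V) :
    T.testQuantity α p w (T.sector y) (T.sector y) ≤ T.weightConst α p w :=
  le_iSup₂_of_le _ (T.sector_mem_dyadic y) le_rfl

variable [DiscreteMeasurableSpace V]

theorem testQuantity_sector (α p : ℝ) (w : V → ℝ) (y y' : V) :
    T.testQuantity α p w (T.sector y) (T.sector y') =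
      T.sectorSum (T.weightMass α w) y / T.sectorMass α y *
        (T.sectorSum (T.dualMass α p w) y' / T.sectorMass α y') ^ (p / p.conjExponent) := by
  rw [testQuantity, laverage_sector, laverage_sector]
  rfl

/-- An average over the whole tree is at most the average over one of the pieces `{0}` and `S_y`,
`y` a child of the origin. -/
theorem exists_laverage_univ_le (hα : 1 < α) (f : V → ℝ≥0∞) :
    ∃ Q, T.IsParent (T.sector T.root) Q ∧
      ⨍⁻ x in T.sector T.root, f x ∂T.measure α ≤ ⨍⁻ x in Q, f x ∂T.measure α := by
  by_contra! hcon
  have hM0 := T.sectorMass_ne_zero α T.root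
  have hMt := T.sectorMass_ne_top hα T.root
  set A := ⨍⁻ x in T.sector T.root, f x ∂T.measure α with hA
  have h0 := hcon _ (T.isParent_singleton T.root)
  rw [laverage_singleton] at h0
  have h1 : ∀ y ∈ T.children T.root,
      T.sectorSum (fun x => f x * T.emass α x) y ≤ A * T.sectorMass α y := by
    intro y hy
    have h := (hcon _ (T.isParent_sector hy)).le
    rw [laverage_sector] at h
    exact (ENNReal.div_le_iff (T.sectorMass_ne_zero α y) (T.sectorMass_ne_top hα y)).1 h
  have e1 : T.sectorSum (fun x => f x * T.emass α x) T.root = A * T.sectorMass α T.root := by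
    rw [hA, laverage_sector, ENNReal.div_mul_cancel hM0 hMt]
  have hAt : A ≠ ∞ := by
    intro hAt
    rw [hAt, ENNReal.top_mul hM0, sectorSum_eq, ENNReal.add_eq_top, ENNReal.sum_eq_top] at e1
    rcases e1 with h | ⟨y, hy, h⟩
    · exact ENNReal.mul_ne_top h0.ne_top (T.emass_ne_top α _) h
    · have h2 := hcon _ (T.isParent_sector hy)
      rw [laverage_sector, h, ENNReal.top_div_of_ne_top (T.sectorMass_ne_top hα y)] at h2
      exact not_top_lt h2
  have e2 : A * T.sectorMass α T.root = A * T.emass α T.root +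
      ∑ y ∈ T.children T.root, A * T.sectorMass α y := by
    rw [sectorMass, sectorSum_eq, mul_add, Finset.mul_sum]; rfl
  rw [sectorSum_eq, e2] at e1
  refine absurd e1 (ne_of_lt ?_)
  refine ENNReal.add_lt_add_of_lt_of_le ?_ ?_ (Finset.sum_le_sum h1)
  · exact (ENNReal.sum_lt_top.2 fun y hy => (lt_of_le_of_lt (h1 y hy)
      (ENNReal.mul_ne_top hAt (T.sectorMass_ne_top hα y)).lt_top)).ne
  · exact ENNReal.mul_lt_mul_left (T.emass_ne_zero α _) (T.emass_ne_top α _) h0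

theorem weightConst_le_siblingWeightConst (hα : 1 < α) (hp : 1 < p) :
    T.weightConst α p w ≤ T.siblingWeightConst α p w := by
  refine iSup₂_le fun Q hQ => ?_
  have hpq := Real.HolderConjugate.conjExponent hp
  have hq0 := hpq.symm.pos
  have hp0 := hpq.pos
  rcases T.dyadic_cases hQ with ⟨x, rfl⟩ | ⟨y, rfl⟩
  · exact T.testQuantity_le_siblingWeightConst ⟨_, T.isParent_singleton x, T.isParent_singleton x⟩
  by_cases hy : y = T.root
  · subst hy
    obtain ⟨Q, hQ, h1⟩ := T.exists_laverage_univ_le hα fun x => ENNReal.ofReal (w x)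
    obtain ⟨R, hR, h2⟩ := T.exists_laverage_univ_le hα
      fun x => ENNReal.ofReal (w x ^ (-(p.conjExponent / p)))
    refine le_trans ?_ (T.testQuantity_le_siblingWeightConst ⟨_, hQ, hR⟩)
    unfold testQuantity
    gcongr
  · have := T.isParent_sector (T.mem_children_parent hy)
    exact T.testQuantity_le_siblingWeightConst ⟨_, this, this⟩

theorem tsum_masses_ne_top (hp : 1 < p) (hα : 1 < α) (hw : ∀ x, 0 < w x)
    (hB : T.weightConst α p w ≠ ∞) :
    ∑' x, T.weightMass α w x ≠ ∞ ∧ ∑' x, T.dualMass α p w x ≠ ∞ := by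
  have hpq := Real.HolderConjugate.conjExponent hp
  have hq0 := hpq.symm.pos
  have hp0 := hpq.pos
  have h := ne_top_of_le_ne_top hB (T.testQuantity_le_weightConst (α := α) (p := p) (w := w) T.root)
  have hM0 := T.sectorMass_ne_zero α T.root
  have hMt := T.sectorMass_ne_top hα T.root
  have h1 := T.sectorSum_ne_zero (T.weightMass_ne_zero (α := α) hw) T.root
  have h2 := T.sectorSum_ne_zero (T.dualMass_ne_zero (α := α) (p := p) hw) T.root
  rw [testQuantity_sector] at h
  rw [← sectorSum_root, ← sectorSum_root]
  constructor
  · intro ht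
    refine h ?_
    rw [ht, ENNReal.top_div_of_ne_top hMt, ENNReal.top_mul]
    have : 0 < T.sectorSum (T.dualMass α p w) T.root / T.sectorMass α T.root :=
      ENNReal.div_pos h2 hMt
    simp only [ne_eq, ENNReal.rpow_eq_zero_iff, not_or, not_and, not_lt]
    exact ⟨fun h0 => absurd h0 this.ne', fun _ => by positivity⟩
  · intro ht
    refine h ?_
    rw [ht, ENNReal.top_div_of_ne_top hMt, ENNReal.top_rpow_of_pos (by positivity),
      ENNReal.mul_top (ENNReal.div_pos h1 hMt).ne']

theorem sectorSum_masses_le (hp : 1 < p) (hα : 1 < α) (hw : ∀ x, 0 < w x) (x : V) :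
    T.sectorSum (T.weightMass α w) x ≤
        doublingConst α ^ p * T.weightConst α p w * T.weightMass α w x ∧
      T.sectorSum (T.dualMass α p w) x ≤
        doublingConst α ^ p.conjExponent * T.weightConst α p w ^ (p.conjExponent / p) *
          T.dualMass α p w x := by
  have hpq := Real.HolderConjugate.conjExponent hp
  have hq0 := hpq.symm.pos
  have hp0 := hpq.pos
  have hM0 := T.sectorMass_ne_zero α x
  have hMt := T.sectorMass_ne_top hα x
  have hM := T.sectorMass_le hα x
  have hB := T.testQuantity_le_weightConst (α := α) (p := p) (w := w) x
  rw [testQuantity_sector] at hB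
  set M := T.sectorMass α x
  set C := doublingConst α
  set B := T.weightConst α p w
  set S := T.sectorSum (T.weightMass α w) x with hS
  set S' := T.sectorSum (T.dualMass α p w) x with hS'
  -- A value at the generating vertex is at most `C` times the average over the sector.
  have hval : ∀ s A : ℝ≥0∞, s * T.emass α x ≤ A → s ≤ C * (A / M) := by
    intro s A h
    rw [← mul_div_assoc, ENNReal.le_div_iff_mul_le (Or.inl hM0) (Or.inl hMt)]
    calc s * M ≤ s * (C * T.emass α x) := by gcongr
      _ = C * (s * T.emass α x) := by ring
      _ ≤ C * A := by gcongr
  have hCsplit : ∀ r : ℝ, 0 ≤ r → C ^ r * C = C ^ (r + 1) := by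
    intro r hr
    conv_lhs => enter [2]; rw [← ENNReal.rpow_one C]
    rw [← ENNReal.rpow_add_of_nonneg _ _ hr zero_le_one]
  have hr1 : p / p.conjExponent + 1 = p := by
    rw [hpq.div_conj_eq_sub_one]; ring
  have hr2 : p.conjExponent / p + 1 = p.conjExponent := by
    rw [hpq.symm.div_conj_eq_sub_one]; ring
  obtain ⟨h1, h2⟩ := ENNReal.le_of_test (r := p / p.conjExponent) (by positivity) hB
    (ofReal_weight_mul_dual hp hw x) (hval _ _ (T.le_sectorSum (T.weightMass α w) x))
    (hval _ _ (T.le_sectorSum (T.dualMass α p w) x))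
  rw [inv_div] at h2
  constructor
  · calc S = S / M * M := (ENNReal.div_mul_cancel hM0 hMt).symm
      _ ≤ C ^ (p / p.conjExponent) * B * ENNReal.ofReal (w x) * (C * T.emass α x) := by gcongr
      _ = C ^ (p / p.conjExponent) * C * B * (ENNReal.ofReal (w x) * T.emass α x) := by ring
      _ = _ := by rw [hCsplit _ (by positivity), hr1]; rfl
  · calc S' = S' / M * M := (ENNReal.div_mul_cancel hM0 hMt).symm
      _ ≤ (C * B) ^ (p.conjExponent / p) * ENNReal.ofReal (w x ^ (-(p.conjExponent / p))) *
            (C * T.emass α x) := by gcongr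
      _ = C ^ (p.conjExponent / p) * C * B ^ (p.conjExponent / p) *
            (ENNReal.ofReal (w x ^ (-(p.conjExponent / p))) * T.emass α x) := by
          rw [ENNReal.mul_rpow_of_nonneg _ _ (by positivity)]; ring
      _ = _ := by rw [hCsplit _ (by positivity), hr2]; rfl

end Weights

/-! ### The positive operator dominating the Bergman projection -/

/-- The coefficients of the positive operator that dominates the Bergman projection: every sector
interacts with itself, and on an equal footing with each of its siblings. -/
def kernelCoeff (y y' : V) : ℝ≥0∞ :=
  ({y} : Set V).indicator 1 y' +
    (T.siblings y : Set V).indicator (fun _ => (T.q (T.level (T.parent y)) : ℝ≥0∞)⁻¹) y'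

theorem kernelCoeff_comm (y y' : V) : T.kernelCoeff y y' = T.kernelCoeff y' y := by
  unfold kernelCoeff
  congr 1
  · by_cases h : y = y'
    · rw [h]
    · rw [Set.indicator_of_notMem (s := {y}) (by simpa using Ne.symm h),
        Set.indicator_of_notMem (s := {y'}) (by simpa using h)]
  · by_cases h : y' ∈ T.siblings y
    · rw [Set.indicator_of_mem (by simpa using h),
        Set.indicator_of_mem (by simpa using T.mem_siblings_comm.1 h), (T.mem_siblings.1 h).2.2]
    · rw [Set.indicator_of_notMem (by simpa using h),
        Set.indicator_of_notMem (by simpa using fun h' => h (T.mem_siblings_comm.1 h'))]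

theorem tsum_kernelCoeff_mul (y : V) (F : V → ℝ≥0∞) :
    ∑' y', T.kernelCoeff y y' * F y' =
      F y + (T.q (T.level (T.parent y)) : ℝ≥0∞)⁻¹ * ∑ y' ∈ T.siblings y, F y' := by
  unfold kernelCoeff
  simp_rw [add_mul]
  rw [ENNReal.tsum_add]
  congr 1
  · rw [tsum_eq_single y]
    · simp
    · intro y' hy'
      rw [Set.indicator_of_notMem (by simpa using hy'), zero_mul]
  · rw [tsum_eq_sum (s := T.siblings y), Finset.mul_sum]
    · refine Finset.sum_congr rfl fun y' hy' => ?_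
      rw [Set.indicator_of_mem (by simpa using hy')]
    · intro y' hy'
      rw [Set.indicator_of_notMem (by simpa using hy'), zero_mul]

theorem tsum_kernelCoeff_le (y : V) : ∑' y', T.kernelCoeff y y' ≤ 2 := by
  have h := T.tsum_kernelCoeff_mul y 1
  simp only [Pi.one_apply, mul_one, Finset.sum_const, nsmul_eq_mul] at h
  rw [h, ← one_add_one_eq_two]
  gcongr
  have h1 : (T.q (T.level (T.parent y)) : ℝ≥0∞) ≠ 0 := by
    have := T.two_le_q (T.level (T.parent y))
    simp only [ne_eq, Nat.cast_eq_zero]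
    omega
  calc (T.q (T.level (T.parent y)) : ℝ≥0∞)⁻¹ * ((T.siblings y).card : ℝ≥0∞)
      ≤ (T.q (T.level (T.parent y)) : ℝ≥0∞)⁻¹ * (T.q (T.level (T.parent y)) : ℝ≥0∞) := by
        gcongr; exact T.card_siblings_le y
    _ = 1 := ENNReal.inv_mul_cancel h1 (ENNReal.natCast_ne_top _)

theorem eq_or_mem_siblings_of_kernelCoeff_ne_zero {y y' : V} (h : T.kernelCoeff y y' ≠ 0) :
    y' = y ∨ y' ∈ T.siblings y := by
  by_contra! hcon
  refine h ?_
  rw [kernelCoeff, Set.indicator_of_notMem (by simpa using hcon.1),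
    Set.indicator_of_notMem (by simpa using hcon.2), add_zero]

/-- The constant of the weighted estimate for the dominating operator. -/
def weightedBound (α p : ℝ) : ℝ≥0∞ :=
  (2 * (doublingConst α ^ p.conjExponent * hardyConst p p.conjExponent)) ^ (1 / p) *
    (2 * (doublingConst α ^ p * hardyConst p.conjExponent p)) ^ (1 / p.conjExponent)

theorem weightedBound_ne_top {α p : ℝ} (hα : 1 < α) (hp : 1 < p) : weightedBound α p ≠ ∞ := by
  have hpq := Real.HolderConjugate.conjExponent hp
  have hq0 := hpq.symm.pos
  have hp0 := hpq.pos
  have hC := doublingConst_ne_top hα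
  have h1 := hardyConst_ne_top p p.conjExponent
  have h2 := hardyConst_ne_top p.conjExponent p
  unfold weightedBound
  refine ENNReal.mul_ne_top ?_ ?_ <;> refine ENNReal.rpow_ne_top_of_nonneg (by positivity)
    (ENNReal.mul_ne_top (by simp) (ENNReal.mul_ne_top
      (ENNReal.rpow_ne_top_of_nonneg (by positivity) hC) ?_)) <;> assumption

section WeightedEstimate

variable [MeasurableSpace V] [DiscreteMeasurableSpace V]

/-- The sibling constant enters through the averages over two sibling sectors, the other constant
through the Carleson condition for `w` and for the dual weight. -/
theorem dyadicOperator_weighted_le {α p : ℝ} (hα : 1 < α) (hp : 1 < p) {w : V → ℝ}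
    (hw : w ∈ T.siblingWeights α p) {f : V → ℝ≥0∞}
    (hf : ∑' z, f z ^ p * T.weightMass α w z ≠ ∞) :
    (∑' z, T.dyadicOperator T.kernelCoeff (T.sectorMass α) (fun z => f z * T.emass α z) z ^ p *
        T.weightMass α w z) ^ (1 / p) ≤
      weightedBound α p * T.siblingWeightConst α p w ^ (1 / p) *
        T.weightConst α p w ^ (p.conjExponent / p ^ 2 + 1 / p.conjExponent) *
        (∑' z, f z ^ p * T.weightMass α w z) ^ (1 / p) := by
  obtain ⟨hw0, hD⟩ := hw
  have hpq := Real.HolderConjugate.conjExponent hp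
  have hq0 := hpq.symm.pos
  have hp0 := hpq.pos
  have hBD := T.weightConst_le_siblingWeightConst (w := w) hα hp
  have hB : T.weightConst α p w ≠ ∞ := (hBD.trans_lt hD).ne
  obtain ⟨hbt, hat⟩ := T.tsum_masses_ne_top hp hα hw0 hB
  have hC := doublingConst_ne_top hα
  set t : V → ℝ≥0∞ := fun z => ENNReal.ofReal (w z ^ (-(p.conjExponent / p))) with ht
  have ht0 : ∀ z, t z ≠ 0 := fun z => (ENNReal.ofReal_pos.2 (Real.rpow_pos_of_pos (hw0 z) _)).ne'
  have htt : ∀ z, t z ≠ ∞ := fun z => ENNReal.ofReal_ne_top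
  have e1 : ∀ z, f z / t z * T.dualMass α p w z = f z * T.emass α z := by
    intro z
    change f z / t z * (t z * T.emass α z) = _
    rw [← mul_assoc, ENNReal.div_mul_cancel (ht0 z) (htt z)]
  have e2 : ∀ z, (f z / t z) ^ p * T.dualMass α p w z = f z ^ p * T.weightMass α w z := by
    intro z
    have h1 : t z ^ (p / p.conjExponent) * ENNReal.ofReal (w z) = 1 :=
      ofReal_weight_mul_dual hp hw0 z
    have h2 : t z = t z ^ p * ENNReal.ofReal (w z) := by
      have : p = p / p.conjExponent + 1 := by rw [hpq.div_conj_eq_sub_one]; ring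
      conv_rhs => rw [this, ENNReal.rpow_add _ _ (ht0 z) (htt z), ENNReal.rpow_one]
      rw [mul_right_comm, h1, one_mul]
    have h3 : t z ^ p ≠ 0 := by simp [ht0, htt]
    have h4 : t z ^ p ≠ ∞ := ENNReal.rpow_ne_top_of_nonneg hp0.le (htt z)
    change (f z / t z) ^ p * (t z * T.emass α z) = f z ^ p * (ENNReal.ofReal (w z) * T.emass α z)
    rw [ENNReal.div_rpow_of_nonneg _ _ hp0.le]
    calc f z ^ p / t z ^ p * (t z * T.emass α z)
        = f z ^ p / t z ^ p * (t z ^ p * ENNReal.ofReal (w z) * T.emass α z) := by rw [← h2]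
      _ = f z ^ p / t z ^ p * t z ^ p * (ENNReal.ofReal (w z) * T.emass α z) := by ring
      _ = _ := by rw [ENNReal.div_mul_cancel h3 h4]
  have hf' : ∑' z, (f z / t z) ^ p * T.dualMass α p w z ≠ ∞ := by simpa only [e2] using hf
  have key := T.dyadicOperator_le hpq (T.dualMass_ne_zero (α := α) (p := p) hw0) hat
    (T.weightMass_ne_zero (α := α) hw0) hbt
    (fun x => (T.sectorSum_masses_le hp hα hw0 x).2)
    (fun x => (T.sectorSum_masses_le hp hα hw0 x).1)
    (ENNReal.mul_ne_top (ENNReal.rpow_ne_top_of_nonneg hq0.le hC)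
      (ENNReal.rpow_ne_top_of_nonneg (by positivity) hB))
    (ENNReal.mul_ne_top (ENNReal.rpow_ne_top_of_nonneg hp0.le hC) hB) hD.ne
    T.tsum_kernelCoeff_le
    (fun y' => by simpa only [T.kernelCoeff_comm _ y'] using T.tsum_kernelCoeff_le y')
    (T.sectorMass_ne_zero α) (T.sectorMass_ne_top hα)
    (fun y y' hc => ?_) hf'
  · simp only [e1, e2] at key
    refine key.trans_eq ?_
    set B := T.weightConst α p w
    set C := doublingConst α
    unfold weightedBound
    have h1 : (2 * (C ^ p.conjExponent * B ^ (p.conjExponent / p) *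
        hardyConst p p.conjExponent)) ^ (1 / p) = (2 * (C ^ p.conjExponent *
          hardyConst p p.conjExponent)) ^ (1 / p) * B ^ (p.conjExponent / p ^ 2) := by
      have : p.conjExponent / p ^ 2 = p.conjExponent / p * (1 / p) := by field_simp
      rw [this, ENNReal.rpow_mul, ← ENNReal.mul_rpow_of_nonneg _ _ (by positivity)]
      congr 1; ring
    have h2 : (2 * (C ^ p * B * hardyConst p.conjExponent p)) ^ (1 / p.conjExponent) =
        (2 * (C ^ p * hardyConst p.conjExponent p)) ^ (1 / p.conjExponent) *
          B ^ (1 / p.conjExponent) := by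
      rw [← ENNReal.mul_rpow_of_nonneg _ _ (by positivity)]
      congr 1; ring
    rw [h1, h2, ENNReal.rpow_add_of_nonneg _ _ (by positivity) (by positivity)]
    ring
  · rcases T.eq_or_mem_siblings_of_kernelCoeff_ne_zero hc with rfl | h
    · rw [← testQuantity_sector]
      exact (T.testQuantity_le_weightConst y').trans hBD
    · have h1 := T.testQuantity_le_siblingWeightConst (α := α) (p := p) (w := w)
        (T.isSibling_of_mem_siblings h)
      rw [testQuantity_sector] at h1
      rwa [T.sectorMass_eq_of_level_eq α (T.level_of_mem_siblings h)] at h1 ⊢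

end WeightedEstimate

/-! ### Harmonic functions -/

/-- With the convention that the origin is its own parent, harmonicity has the same form at all
vertices: the increments to the children add up to the increment from the parent. -/
theorem laplacian_eq_zero_iff {f : V → ℝ} {x : V} :
    T.laplacian f x = 0 ↔ ∑ y ∈ T.children x, (f y - f x) = f x - f (T.parent x) := by
  have hq := T.q_pos (T.level x)
  rw [laplacian, Finset.sum_sub_distrib, Finset.sum_const, card_children, nsmul_eq_mul]
  by_cases hx : x = T.root
  · subst hx
    rw [level_root] at hq ⊢
    rw [neighborFinset_root, T.degree_root, parent_root]
    constructor <;> intro h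
    · field_simp at h; linarith
    · field_simp; linarith
  · rw [T.neighborFinset_of_ne_root hx, Finset.sum_cons, T.degree_of_ne_root x hx]
    change f x - ((T.q (T.level x) + 1 : ℕ) : ℝ)⁻¹ * _ = 0 ↔ _
    push_cast
    have hq' : (T.q (T.level x) : ℝ) + 1 ≠ 0 := by positivity
    constructor <;> intro h
    · field_simp at h; linarith
    · field_simp; linarith

/-- The value `∑_{i ≤ n} ∏_{l < i} q(k + l)⁻¹`, taken at distance `n` from `y` by the function on
the sector of `y`, at level `k`, that depends on the level only, equals `1` at `y`, and is harmonic
on the sector when it is extended by `0` to the parent of `y`. -/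
def radialValue (k n : ℕ) : ℝ :=
  ∑ i ∈ Finset.range (n + 1), ∏ l ∈ Finset.range i, (T.q (k + l) : ℝ)⁻¹

@[simp]
theorem radialValue_zero (k : ℕ) : T.radialValue k 0 = 1 := by simp [radialValue]

theorem radialValue_succ (k n : ℕ) :
    T.radialValue k (n + 1) = 1 + (T.q k : ℝ)⁻¹ * T.radialValue (k + 1) n := by
  rw [radialValue, Finset.sum_range_succ', Finset.prod_range_zero, add_comm, radialValue,
    Finset.mul_sum]
  congr 1
  refine Finset.sum_congr rfl fun i _ => ?_
  rw [Finset.prod_range_succ', mul_comm, add_zero]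
  congr 1
  exact Finset.prod_congr rfl fun l _ => by congr 3; omega

theorem radialValue_succ_sub (k n : ℕ) :
    T.radialValue k (n + 1) - T.radialValue k n =
      ∏ l ∈ Finset.range (n + 1), (T.q (k + l) : ℝ)⁻¹ := by
  rw [radialValue, Finset.sum_range_succ, ← radialValue, add_sub_cancel_left]

theorem radialValue_nonneg (k n : ℕ) : 0 ≤ T.radialValue k n :=
  Finset.sum_nonneg fun _ _ => Finset.prod_nonneg fun _ _ => by positivity

theorem one_le_radialValue (k n : ℕ) : 1 ≤ T.radialValue k n := by
  cases n with
  | zero => simp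
  | succ n =>
    rw [radialValue_succ]
    have := T.radialValue_nonneg (k + 1) n
    have := T.q_pos k
    exact le_add_of_nonneg_right (by positivity)

theorem radialValue_le_two (k n : ℕ) : T.radialValue k n ≤ 2 := by
  induction n generalizing k with
  | zero => simp
  | succ n ih =>
    rw [radialValue_succ]
    have h1 : (2 : ℝ) ≤ T.q k := by exact_mod_cast T.two_le_q k
    have h2 : (T.q k : ℝ)⁻¹ ≤ 2⁻¹ := inv_anti₀ two_pos h1
    have h3 := mul_le_mul h2 (ih (k + 1)) (T.radialValue_nonneg _ _) (by norm_num)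
    linarith

/-- The sums of a harmonic function over the generations of a sector depend only on its values at
the generating vertex and at the parent of that vertex. -/
theorem sum_descendants_of_harmonic {h : V → ℝ} (hh : ∀ x, T.laplacian h x = 0) (n : ℕ) (y : V) :
    ∑ z ∈ T.descendants n y, h z = (T.descendants n y).card *
      (h (T.parent y) + (h y - h (T.parent y)) * T.radialValue (T.level y) n) := by
  induction n generalizing y with
  | zero => simp [descendants]
  | succ n ih =>
    have hq := T.q_pos (T.level y)
    set N := ∏ l ∈ Finset.range n, T.q (T.level y + 1 + l) with hN
    have hcard : ∀ v ∈ T.children y, (T.descendants n v).card = N := fun v hv => by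
      rw [card_descendants, T.level_of_mem_children hv]
    have hcard' : (T.descendants (n + 1) y).card = T.q (T.level y) * N := by
      have h1 := T.sum_descendants_succ (fun _ => 1) n y
      simp only [Finset.sum_const, smul_eq_mul, mul_one] at h1
      rw [h1, Finset.sum_congr rfl hcard, Finset.sum_const, card_children, smul_eq_mul]
    have hsum := T.laplacian_eq_zero_iff.1 (hh y)
    rw [sum_descendants_succ, hcard', radialValue_succ]
    calc ∑ v ∈ T.children y, ∑ z ∈ T.descendants n v, h z
        = ∑ v ∈ T.children y, ((N : ℝ) * h y +
            N * T.radialValue (T.level y + 1) n * (h v - h y)) := by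
          refine Finset.sum_congr rfl fun v hv => ?_
          rw [ih v, hcard v hv, (T.mem_children.1 hv).2, T.level_of_mem_children hv]
          ring
      _ = T.q (T.level y) * (N * h y) +
            N * T.radialValue (T.level y + 1) n * (h y - h (T.parent y)) := by
          rw [Finset.sum_add_distrib, Finset.sum_const, card_children, nsmul_eq_mul,
            ← Finset.mul_sum, hsum]
      _ = _ := by push_cast; field_simp; ring

/-! ### Radial functions on sectors and their inner products with harmonic functions -/

/-- The mass of the `n`-th generation of descendants of a vertex at level `k`. -/
def generationMass (α : ℝ) (k n : ℕ) : ℝ :=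
  (∏ l ∈ Finset.range n, (T.q (k + l) : ℝ)) *
    ∏ ℓ ∈ Finset.range (k + n), ((T.q ℓ : ℝ) ^ α)⁻¹

theorem sum_mass_descendants_mul (α : ℝ) (f : V → ℝ) (n : ℕ) (y : V) :
    ∑ z ∈ T.descendants n y, T.mass α z * f z =
      (∏ ℓ ∈ Finset.range (T.level y + n), ((T.q ℓ : ℝ) ^ α)⁻¹) * ∑ z ∈ T.descendants n y, f z := by
  rw [Finset.mul_sum]
  refine Finset.sum_congr rfl fun z hz => ?_
  rw [mass, (T.mem_descendants.1 hz).2]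

theorem summable_mass {α : ℝ} (hα : 1 < α) : Summable (T.mass α) := by
  have h := T.sectorMass_ne_top hα T.root
  rw [sectorMass, sectorSum_root] at h
  refine (ENNReal.summable_toReal h).congr fun x => ?_
  rw [emass, ENNReal.toReal_ofReal (T.mass_pos α x).le]

/-- The sum over a sector of a harmonic function against a bounded function of the distance to the
generating vertex. -/
theorem hasSum_harmonic_radial {α : ℝ} {h : V → ℝ} (hh : ∀ x, T.laplacian h x = 0)
    (hs : Summable fun x => T.mass α x * h x) {ρ : ℕ → ℝ} {c : ℝ} (hρ : ∀ n, |ρ n| ≤ c) (y : V) :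
    HasSum (fun n => T.generationMass α (T.level y) n * ρ n *
        (h (T.parent y) + (h y - h (T.parent y)) * T.radialValue (T.level y) n))
      (∑' u, (T.sector y).indicator
        (fun u => T.mass α u * h u * ρ (T.level u - T.level y)) u) := by
  have hs' : Summable fun u => T.mass α u * h u * ρ (T.level u - T.level y) := by
    refine Summable.of_norm_bounded (hs.norm.mul_right c) fun u => ?_
    rw [norm_mul]
    gcongr
    exact hρ _
  convert T.hasSum_descendants hs' y using 1
  funext n
  have h1 : ∀ z ∈ T.descendants n y, T.mass α z * h z * ρ (T.level z - T.level y) =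
      T.mass α z * h z * ρ n := fun z hz => by
    rw [(T.mem_descendants.1 hz).2, Nat.add_sub_cancel_left]
  rw [Finset.sum_congr rfl h1, ← Finset.sum_mul, sum_mass_descendants_mul,
    T.sum_descendants_of_harmonic hh, card_descendants, generationMass]
  push_cast
  ring

/-- The radial function on the sector of `y`, extended by `0`, with the values `radialValue`. -/
def radial (y u : V) : ℝ :=
  (T.sector y).indicator (fun u => T.radialValue (T.level y) (T.level u - T.level y)) u

theorem radial_nonneg (y u : V) : 0 ≤ T.radial y u :=
  Set.indicator_nonneg (fun _ _ => T.radialValue_nonneg _ _) u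

theorem radial_le (y u : V) : T.radial y u ≤ 2 * (T.sector y).indicator 1 u := by
  by_cases h : u ∈ T.sector y
  · simpa [radial, h] using T.radialValue_le_two _ _
  · simp [radial, h]

/-- The squared norm of `radial y` in `L²(μ)`, for `y` at level `k`. -/
def radialNormSq (α : ℝ) (k : ℕ) : ℝ :=
  ∑' n, T.generationMass α k n * T.radialValue k n * T.radialValue k n

theorem generationMass_nonneg (α : ℝ) (k n : ℕ) : 0 ≤ T.generationMass α k n :=
  mul_nonneg (Finset.prod_nonneg fun _ _ => by positivity)
    (Finset.prod_nonneg fun _ _ => by positivity)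

theorem hasSum_generationMass {α : ℝ} (hα : 1 < α) (y : V) :
    HasSum (T.generationMass α (T.level y)) (T.sectorMass α y).toReal := by
  have h1 := T.hasSum_descendants (T.summable_mass hα) y
  convert h1 using 1
  · funext n
    have := T.sum_mass_descendants_mul α (fun _ => 1) n y
    simp only [mul_one, Finset.sum_const, nsmul_eq_mul, card_descendants] at this
    rw [this, generationMass]
    push_cast
    ring
  · rw [sectorMass, sectorSum, ENNReal.tsum_toReal_eq]
    · refine tsum_congr fun z => ?_
      by_cases hz : z ∈ T.sector y
      · simp [hz, emass, (T.mass_pos α z).le]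
      · simp [hz]
    · intro z
      by_cases hz : z ∈ T.sector y
      · simp [hz, emass]
      · simp [hz]

theorem summable_generationMass_mul {α : ℝ} (hα : 1 < α) (y : V) {ρ : ℕ → ℝ} {c : ℝ}
    (hρ : ∀ n, |ρ n| ≤ c) : Summable fun n => T.generationMass α (T.level y) n * ρ n := by
  refine Summable.of_norm_bounded ((T.hasSum_generationMass hα y).summable.mul_right c) fun n => ?_
  rw [norm_mul, Real.norm_of_nonneg (T.generationMass_nonneg α _ n)]
  gcongr
  · exact T.generationMass_nonneg α _ n
  · exact hρ n

theorem abs_radialValue_le (k n : ℕ) : |T.radialValue k n| ≤ 2 := by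
  rw [abs_of_nonneg (T.radialValue_nonneg k n)]
  exact T.radialValue_le_two k n

theorem summable_radialNormSq {α : ℝ} (hα : 1 < α) (y : V) : Summable fun n =>
    T.generationMass α (T.level y) n * T.radialValue (T.level y) n *
      T.radialValue (T.level y) n := by
  simp_rw [mul_assoc]
  refine T.summable_generationMass_mul hα y (c := 2 * 2) fun n => ?_
  rw [abs_mul]
  gcongr <;> exact T.abs_radialValue_le _ _

theorem sectorMass_le_radialNormSq {α : ℝ} (hα : 1 < α) (y : V) :
    (T.sectorMass α y).toReal ≤ T.radialNormSq α (T.level y) := by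
  refine hasSum_le (fun n => ?_) (T.hasSum_generationMass hα y) (T.summable_radialNormSq hα y).hasSum
  have h1 := T.one_le_radialValue (T.level y) n
  rw [mul_assoc]
  refine le_mul_of_one_le_right (T.generationMass_nonneg α _ n) ?_
  nlinarith

theorem sectorMass_toReal_pos {α : ℝ} (hα : 1 < α) (y : V) : 0 < (T.sectorMass α y).toReal :=
  ENNReal.toReal_pos (T.sectorMass_ne_zero α y) (T.sectorMass_ne_top hα y)

theorem radialNormSq_pos {α : ℝ} (hα : 1 < α) (y : V) : 0 < T.radialNormSq α (T.level y) :=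
  (T.sectorMass_toReal_pos hα y).trans_le (T.sectorMass_le_radialNormSq hα y)

/-- The inner product of a harmonic function with a radial function on a sector. -/
theorem tsum_radial_mul {α : ℝ} (hα : 1 < α) {h : V → ℝ} (hh : ∀ x, T.laplacian h x = 0)
    (hs : Summable fun x => T.mass α x * h x) (y : V) :
    ∑' u, T.mass α u * h u * T.radial y u =
      h (T.parent y) * (∑' n, T.generationMass α (T.level y) n * T.radialValue (T.level y) n) +
        (h y - h (T.parent y)) * T.radialNormSq α (T.level y) := by
  have h1 := T.hasSum_harmonic_radial hh hs (T.abs_radialValue_le (T.level y)) y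
  have h2 := (T.summable_generationMass_mul hα y (T.abs_radialValue_le (T.level y))).hasSum
  have h3 := (T.summable_radialNormSq hα y).hasSum
  have h4 := (h2.mul_left (h (T.parent y))).add (h3.mul_left (h y - h (T.parent y)))
  have h5 : ∑' u, T.mass α u * h u * T.radial y u = ∑' u, (T.sector y).indicator
      (fun u => T.mass α u * h u * T.radialValue (T.level y) (T.level u - T.level y)) u := by
    refine tsum_congr fun u => ?_
    by_cases hu : u ∈ T.sector y <;> simp [radial, hu]
  rw [h5, radialNormSq]
  exact h1.unique (h4.congr_fun fun n => by ring)

theorem tsum_mass_mul_harmonic {α : ℝ} (hα : 1 < α) {h : V → ℝ} (hh : ∀ x, T.laplacian h x = 0)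
    (hs : Summable fun x => T.mass α x * h x) :
    ∑' u, T.mass α u * h u = h T.root * (T.sectorMass α T.root).toReal := by
  have h1 := T.hasSum_harmonic_radial hh hs (ρ := fun _ => 1) (c := 1) (by simp) T.root
  have h2 := (T.hasSum_generationMass hα T.root).mul_left (h T.root)
  simp only [mul_one, sector_root, Set.indicator_univ, parent_root, sub_self, zero_mul,
    add_zero] at h1
  refine h1.unique ?_
  simpa only [mul_comm] using h2

/-- The radial functions on sibling sectors, normalized to be harmonic: the mean of their values at
the siblings is subtracted. -/
def harmonicRadial (y u : V) : ℝ :=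
  T.radial y u - (T.q (T.level (T.parent y)) : ℝ)⁻¹ * ∑ y' ∈ T.siblings y, T.radial y' u

theorem siblings_of_ne_root {y : V} (hy : y ≠ T.root) : T.siblings y = T.children (T.parent y) :=
  if_neg hy

theorem summable_mul_radial {α : ℝ} {h : V → ℝ} (hs : Summable fun x => T.mass α x * h x) (y : V) :
    Summable fun u => T.mass α u * h u * T.radial y u := by
  refine Summable.of_norm_bounded (hs.norm.mul_right 2) fun u => ?_
  rw [norm_mul, Real.norm_of_nonneg (T.radial_nonneg y u)]
  gcongr
  refine (T.radial_le y u).trans ?_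
  have : (T.sector y).indicator (1 : V → ℝ) u ≤ 1 := Set.indicator_le_self' (by simp) u
  linarith

theorem summable_mul_harmonicRadial {α : ℝ} {h : V → ℝ} (hs : Summable fun x => T.mass α x * h x)
    (y : V) : Summable fun u => T.mass α u * h u * T.harmonicRadial y u := by
  have h1 := (T.summable_mul_radial hs y).sub ((summable_sum (s := T.siblings y)
    fun y' _ => T.summable_mul_radial hs y').mul_left (T.q (T.level (T.parent y)) : ℝ)⁻¹)
  refine h1.congr fun u => ?_
  rw [harmonicRadial, ← Finset.mul_sum]
  ring

theorem tsum_harmonicRadial_mul {α : ℝ} (hα : 1 < α) {h : V → ℝ} (hh : ∀ x, T.laplacian h x = 0)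
    (hs : Summable fun x => T.mass α x * h x) {y : V} (hy : y ≠ T.root) :
    ∑' u, T.mass α u * h u * T.harmonicRadial y u =
      T.radialNormSq α (T.level y) * ((h y - h (T.parent y)) -
        (T.q (T.level (T.parent y)) : ℝ)⁻¹ * (h (T.parent y) - h (T.parent (T.parent y)))) := by
  have hq := T.q_pos (T.level (T.parent y))
  have h1 : ∀ u, T.mass α u * h u * T.harmonicRadial y u = T.mass α u * h u * T.radial y u -
      (T.q (T.level (T.parent y)) : ℝ)⁻¹ *
        ∑ y' ∈ T.siblings y, T.mass α u * h u * T.radial y' u := fun u => by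
    rw [harmonicRadial, ← Finset.mul_sum]
    ring
  have hsr := fun y => T.summable_mul_radial hs y
  simp_rw [h1]
  rw [(hsr y).tsum_sub ((summable_sum fun y' _ => hsr y').mul_left _), tsum_mul_left,
    Summable.tsum_finsetSum (fun y' _ => hsr y'), T.tsum_radial_mul hα hh hs]
  set M := ∑' n, T.generationMass α (T.level y) n * T.radialValue (T.level y) n with hM
  have h2 : ∀ y' ∈ T.siblings y, ∑' u, T.mass α u * h u * T.radial y' u =
      h (T.parent y) * M + (h y' - h (T.parent y)) * T.radialNormSq α (T.level y) := by
    intro y' hy'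
    rw [T.tsum_radial_mul hα hh hs, T.level_of_mem_siblings hy', (T.mem_siblings.1 hy').2.2]
  rw [Finset.sum_congr rfl h2, T.siblings_of_ne_root hy, Finset.sum_add_distrib, Finset.sum_const,
    card_children, nsmul_eq_mul, ← Finset.sum_mul, T.laplacian_eq_zero_iff.1 (hh (T.parent y))]
  field_simp
  ring

/-- A radial function on the sector of `y` fails to be harmonic at the parent of `y` only. -/
theorem sum_children_radial {y : V} (hy : y ≠ T.root) (u : V) :
    ∑ v ∈ T.children u, (T.radial y v - T.radial y u) - (T.radial y u - T.radial y (T.parent u)) =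
      ({T.parent y} : Set V).indicator 1 u := by
  classical
  have hpy : T.parent y ∉ T.sector y :=
    T.self_notMem_sector_of_mem_children (T.mem_children_parent hy)
  by_cases hu : u ∈ T.sector y
  · have hne : u ≠ T.parent y := fun h => hpy (h ▸ hu)
    rw [Set.indicator_of_notMem (s := {T.parent y}) (by simpa using hne)]
    obtain ⟨n, hn⟩ : ∃ n, T.level u = T.level y + n :=
      ⟨_, (Nat.add_sub_cancel' (T.level_le_of_mem_sector hu)).symm⟩
    have hru : T.radial y u = T.radialValue (T.level y) n := by
      rw [radial, Set.indicator_of_mem hu, hn, Nat.add_sub_cancel_left]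
    have hv : ∀ v ∈ T.children u, T.radial y v - T.radial y u =
        ∏ l ∈ Finset.range (n + 1), (T.q (T.level y + l) : ℝ)⁻¹ := by
      intro v hv
      have hvs : v ∈ T.sector y := by
        by_cases hvy : v = y
        · rw [hvy]; exact T.self_mem_sector y
        · refine (T.mem_sector_iff_parent hvy).2 ⟨(T.mem_children.1 hv).1, ?_⟩
          rwa [(T.mem_children.1 hv).2]
      rw [hru, radial, Set.indicator_of_mem hvs, T.level_of_mem_children hv, hn,
        add_assoc, Nat.add_sub_cancel_left, radialValue_succ_sub]
    have hp : T.radial y u - T.radial y (T.parent u) =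
        ∏ l ∈ Finset.range n, (T.q (T.level y + l) : ℝ)⁻¹ := by
      cases n with
      | zero =>
        have huy : u = y := T.eq_of_mem_sector_of_level_le hu hn.le
        rw [hru, huy, radial, Set.indicator_of_notMem hpy]
        simp
      | succ n =>
        have huy : u ≠ y := by
          rintro rfl
          omega
        obtain ⟨hur, hup⟩ := (T.mem_sector_iff_parent huy).1 hu
        have hl : T.level (T.parent u) - T.level y = n := by
          have := T.level_parent hur
          omega
        rw [hru, radial, Set.indicator_of_mem hup, hl, radialValue_succ_sub]
    have hq := T.q_pos (T.level u)
    rw [Finset.sum_congr rfl hv, hp, Finset.sum_const, card_children, nsmul_eq_mul,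
      Finset.prod_range_succ, ← hn]
    field_simp
    ring
  · have hru : T.radial y u = 0 := Set.indicator_of_notMem hu _
    have hrp : T.radial y (T.parent u) = 0 := by
      refine Set.indicator_of_notMem (fun h => hu ?_) _
      by_cases hur : u = T.root
      · rwa [hur, parent_root, ← hur] at h
      · refine (T.mem_sector_iff_parent fun huy => hu ?_).2 ⟨hur, h⟩
        rw [huy]; exact T.self_mem_sector y
    have hv : ∀ v ∈ T.children u, T.radial y v = if v = y then 1 else 0 := by
      intro v hv
      split_ifs with hvy
      · rw [hvy, radial, Set.indicator_of_mem (T.self_mem_sector y)]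
        simp
      · refine Set.indicator_of_notMem (fun h => hu ?_) _
        rw [← (T.mem_children.1 hv).2]
        exact ((T.mem_sector_iff_parent hvy).1 h).2
    simp only [hru, hrp, sub_zero]
    rw [Finset.sum_congr rfl hv, Finset.sum_ite_eq']
    by_cases huy : u = T.parent y
    · rw [if_pos (huy ▸ T.mem_children_parent hy), Set.indicator_of_mem (s := {T.parent y}) huy]
      rfl
    · rw [if_neg (fun h => huy (T.mem_children.1 h).2.symm),
        Set.indicator_of_notMem (s := {T.parent y}) huy]

theorem laplacian_harmonicRadial {y : V} (hy : y ≠ T.root) (u : V) :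
    T.laplacian (T.harmonicRadial y) u = 0 := by
  rw [laplacian_eq_zero_iff, ← sub_eq_zero]
  have hq := T.q_pos (T.level (T.parent y))
  have h1 : ∑ v ∈ T.children u, (T.harmonicRadial y v - T.harmonicRadial y u) -
      (T.harmonicRadial y u - T.harmonicRadial y (T.parent u)) =
      (∑ v ∈ T.children u, (T.radial y v - T.radial y u) -
        (T.radial y u - T.radial y (T.parent u))) -
      (T.q (T.level (T.parent y)) : ℝ)⁻¹ * ∑ y' ∈ T.siblings y,
        (∑ v ∈ T.children u, (T.radial y' v - T.radial y' u) -
          (T.radial y' u - T.radial y' (T.parent u))) := by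
    simp only [harmonicRadial, Finset.sum_sub_distrib, Finset.sum_const, ← Finset.mul_sum]
    rw [Finset.sum_comm (s := T.children u), ← Finset.smul_sum]
    simp only [nsmul_eq_mul]
    ring
  have h2 : ∀ y' ∈ T.siblings y, (∑ v ∈ T.children u, (T.radial y' v - T.radial y' u) -
          (T.radial y' u - T.radial y' (T.parent u))) =
        ({T.parent y} : Set V).indicator 1 u := by
    intro y' hy'
    rw [T.sum_children_radial (T.mem_siblings.1 hy').2.1, (T.mem_siblings.1 hy').2.2]
  rw [h1, T.sum_children_radial hy, Finset.sum_congr rfl h2, Finset.sum_const,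
    T.siblings_of_ne_root hy, card_children, nsmul_eq_mul]
  field_simp
  ring

/-! ### The Bergman kernel -/

theorem level_iterate_parent (z : V) {i : ℕ} (hi : i ≤ T.level z) :
    T.level (T.parent^[i] z) = T.level z - i := by
  induction i with
  | zero => simp
  | succ i ih =>
    have h1 := ih (by omega)
    have hne : T.parent^[i] z ≠ T.root := by
      intro h
      rw [h, level_root] at h1
      omega
    have h2 := T.level_parent hne
    rw [Function.iterate_succ_apply']
    omega

theorem iterate_parent_ne_root {z : V} {i : ℕ} (hi : i < T.level z) : T.parent^[i] z ≠ T.root := by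
  intro h
  have := T.level_iterate_parent z hi.le
  rw [h, level_root] at this
  omega

theorem iterate_parent_level (z : V) : T.parent^[T.level z] z = T.root :=
  T.level_eq_zero_iff.1 (by rw [T.level_iterate_parent z le_rfl, Nat.sub_self])

theorem mem_sector_iterate_parent (z : V) (i : ℕ) : z ∈ T.sector (T.parent^[i] z) := by
  induction i with
  | zero => exact T.self_mem_sector z
  | succ i ih =>
    rw [Function.iterate_succ_apply']
    exact T.sector_subset_sector_parent _ ih

/-- The explicit form of the Bergman kernel `K(z, ·)`: the sum runs over the ancestors
`parent^[i] z` of `z`, with `z` itself included and the origin excluded. -/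
def explicitKernel (α : ℝ) (z u : V) : ℝ :=
  (T.sectorMass α T.root).toReal⁻¹ + ∑ i ∈ Finset.range (T.level z),
    T.radialValue (T.level z - i) i / T.radialNormSq α (T.level z - i) *
      T.harmonicRadial (T.parent^[i] z) u

theorem laplacian_explicitKernel (α : ℝ) (z u : V) : T.laplacian (T.explicitKernel α z) u = 0 := by
  rw [laplacian_eq_zero_iff]
  have h1 : ∀ i ∈ Finset.range (T.level z), _ := fun i hi =>
    T.laplacian_eq_zero_iff.1 (T.laplacian_harmonicRadial
      (T.iterate_parent_ne_root (Finset.mem_range.1 hi)) u)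
  simp only [explicitKernel, add_sub_add_left_eq_sub, ← Finset.sum_sub_distrib, ← mul_sub]
  rw [Finset.sum_comm]
  refine Finset.sum_congr rfl fun i hi => ?_
  rw [← Finset.mul_sum, h1 i hi]

/-- The increments of `h` along the path from `z` to the origin telescope against the values of the
radial functions. -/
theorem telescope_radialValue (h : V → ℝ) (z : V) {m : ℕ} (hm : m ≤ T.level z) :
    h (T.parent^[m] z) + (h (T.parent^[m] z) - h (T.parent^[m + 1] z)) *
        (T.radialValue (T.level z - m) m - 1) +
      ∑ i ∈ Finset.range m, T.radialValue (T.level z - i) i *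
        ((h (T.parent^[i] z) - h (T.parent^[i + 1] z)) - (T.q (T.level z - i - 1) : ℝ)⁻¹ *
          (h (T.parent^[i + 1] z) - h (T.parent^[i + 2] z))) = h z := by
  induction m with
  | zero => simp
  | succ m ih =>
    have h1 := ih (by omega)
    have h2 : T.level z - m = T.level z - (m + 1) + 1 := by omega
    have h3 := T.radialValue_succ (T.level z - (m + 1)) m
    rw [← h2] at h3
    rw [Finset.sum_range_succ, h3, Nat.sub_sub]
    linear_combination h1

/-- The reproducing property. -/
theorem tsum_explicitKernel_mul {α : ℝ} (hα : 1 < α) {h : V → ℝ} (hh : ∀ x, T.laplacian h x = 0)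
    (hs : Summable fun x => T.mass α x * h x) (z : V) :
    ∑' u, T.mass α u * h u * T.explicitKernel α z u = h z := by
  have hM := T.sectorMass_toReal_pos hα T.root
  have hterm := fun y => T.summable_mul_harmonicRadial hs y
  have e1 : ∀ u, T.mass α u * h u * T.explicitKernel α z u =
      (T.sectorMass α T.root).toReal⁻¹ * (T.mass α u * h u) +
      ∑ i ∈ Finset.range (T.level z), T.radialValue (T.level z - i) i /
        T.radialNormSq α (T.level z - i) *
          (T.mass α u * h u * T.harmonicRadial (T.parent^[i] z) u) := by
    intro u
    simp only [explicitKernel, mul_add, Finset.mul_sum]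
    congr 1
    · ring
    · exact Finset.sum_congr rfl fun i _ => by ring
  simp_rw [e1]
  rw [(hs.mul_left _).tsum_add (summable_sum fun i _ => (hterm _).mul_left _), tsum_mul_left,
    T.tsum_mass_mul_harmonic hα hh hs, Summable.tsum_finsetSum (fun i _ => (hterm _).mul_left _)]
  have e2 : ∀ i ∈ Finset.range (T.level z), ∑' u, T.radialValue (T.level z - i) i /
        T.radialNormSq α (T.level z - i) *
          (T.mass α u * h u * T.harmonicRadial (T.parent^[i] z) u) =
      T.radialValue (T.level z - i) i *
        ((h (T.parent^[i] z) - h (T.parent^[i + 1] z)) - (T.q (T.level z - i - 1) : ℝ)⁻¹ *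
          (h (T.parent^[i + 1] z) - h (T.parent^[i + 2] z))) := by
    intro i hi
    have hi' := Finset.mem_range.1 hi
    have hl := T.level_iterate_parent z hi'.le
    have hl' := T.level_iterate_parent z (Nat.succ_le_of_lt hi')
    have hN := T.radialNormSq_pos hα (T.parent^[i] z)
    rw [Function.iterate_succ_apply'] at hl'
    rw [tsum_mul_left, T.tsum_harmonicRadial_mul hα hh hs (T.iterate_parent_ne_root hi'), hl', hl,
      Function.iterate_succ_apply', Function.iterate_succ_apply', Function.iterate_succ_apply',
      Nat.succ_eq_add_one, Nat.sub_sub]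
    rw [hl] at hN
    field_simp
  rw [Finset.sum_congr rfl e2]
  have h3 := T.telescope_radialValue h z le_rfl
  rw [Function.iterate_succ_apply', iterate_parent_level, parent_root, sub_self, zero_mul,
    add_zero] at h3
  rw [← h3]
  congr 1
  field_simp

/-! ### The size of the kernel -/

/-- The kernel of the dominating operator, restricted to one sector in the first variable. -/
theorem tsum_kernelCoeff_indicator {α : ℝ} (y u : V) :
    ∑' y', T.kernelCoeff y y' / T.sectorMass α y' * (T.sector y').indicator 1 u =
      (T.sectorMass α y)⁻¹ * ((T.sector y).indicator 1 u +
        (T.q (T.level (T.parent y)) : ℝ≥0∞)⁻¹ * ∑ y' ∈ T.siblings y,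
          (T.sector y').indicator 1 u) := by
  have h := T.tsum_kernelCoeff_mul y
    fun y' => (T.sectorMass α y')⁻¹ * (T.sector y').indicator (1 : V → ℝ≥0∞) u
  simp only [div_eq_mul_inv, mul_assoc]
  rw [h, mul_add]
  congr 1
  rw [mul_left_comm]
  congr 1
  rw [Finset.mul_sum]
  refine Finset.sum_congr rfl fun y' hy' => ?_
  rw [T.sectorMass_eq_of_level_eq α (T.level_of_mem_siblings hy')]

theorem abs_harmonicRadial_le (y u : V) :
    |T.harmonicRadial y u| ≤ 2 * ((T.sector y).indicator 1 u +
      (T.q (T.level (T.parent y)) : ℝ)⁻¹ * ∑ y' ∈ T.siblings y, (T.sector y').indicator 1 u) := by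
  have hq := T.q_pos (T.level (T.parent y))
  rw [harmonicRadial]
  refine (abs_sub _ _).trans ?_
  rw [abs_of_nonneg (T.radial_nonneg y u), abs_of_nonneg (mul_nonneg (inv_nonneg.2 hq.le)
    (Finset.sum_nonneg fun y' _ => T.radial_nonneg y' u)), mul_add,
    mul_left_comm 2, Finset.mul_sum _ _ (2 : ℝ)]
  gcongr
  · exact T.radial_le y u
  · exact T.radial_le _ u

theorem ofReal_indicator_one (s : Set V) (u : V) :
    ENNReal.ofReal (s.indicator 1 u) = s.indicator 1 u := by
  by_cases h : u ∈ s <;> simp [h]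

theorem enorm_kernel_term_le {α : ℝ} (hα : 1 < α) (y u : V) (i : ℕ) :
    ‖T.radialValue (T.level y) i / T.radialNormSq α (T.level y) * T.harmonicRadial y u‖ₑ ≤
      4 * ∑' y', T.kernelCoeff y y' / T.sectorMass α y' * (T.sector y').indicator 1 u := by
  have hM := T.sectorMass_toReal_pos hα y
  have hN := T.radialNormSq_pos hα y
  have hq := T.q_pos (T.level (T.parent y))
  set E : ℝ := (T.sector y).indicator 1 u +
      (T.q (T.level (T.parent y)) : ℝ)⁻¹ * ∑ y' ∈ T.siblings y, (T.sector y').indicator 1 u with hE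
  have hE0 : ∀ y', 0 ≤ (T.sector y').indicator (1 : V → ℝ) u := fun y' =>
    Set.indicator_nonneg (fun _ _ => zero_le_one) u
  have hE1 : 0 ≤ E := add_nonneg (hE0 y) (mul_nonneg (inv_nonneg.2 hq.le)
    (Finset.sum_nonneg fun y' _ => hE0 y'))
  have h1 : |T.radialValue (T.level y) i / T.radialNormSq α (T.level y) * T.harmonicRadial y u| ≤
      4 * ((T.sectorMass α y).toReal⁻¹ * E) := by
    rw [abs_mul, abs_div, abs_of_pos hN]
    calc |T.radialValue (T.level y) i| / T.radialNormSq α (T.level y) * |T.harmonicRadial y u|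
        ≤ 2 / (T.sectorMass α y).toReal * (2 * E) := by
          gcongr
          · exact T.abs_radialValue_le _ _
          · exact T.sectorMass_le_radialNormSq hα y
          · exact T.abs_harmonicRadial_le y u
      _ = _ := by ring
  rw [Real.enorm_eq_ofReal_abs, tsum_kernelCoeff_indicator]
  refine (ENNReal.ofReal_le_ofReal h1).trans_eq ?_
  rw [ENNReal.ofReal_mul (by norm_num), ENNReal.ofReal_mul (inv_nonneg.2 hM.le),
    ENNReal.ofReal_inv_of_pos hM, ENNReal.ofReal_toReal (T.sectorMass_ne_top hα y), hE,
    ENNReal.ofReal_add (hE0 y) (mul_nonneg (inv_nonneg.2 hq.le)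
      (Finset.sum_nonneg fun y' _ => hE0 y')), ENNReal.ofReal_mul (inv_nonneg.2 hq.le),
    ENNReal.ofReal_inv_of_pos hq, ENNReal.ofReal_natCast,
    ENNReal.ofReal_sum_of_nonneg (fun y' _ => hE0 y')]
  simp only [ofReal_indicator_one]
  norm_num

/-- The Bergman kernel is dominated by the kernel of the positive dyadic operator. -/
theorem enorm_explicitKernel_le {α : ℝ} (hα : 1 < α) (z u : V) :
    ‖T.explicitKernel α z u‖ₑ ≤ 4 * ∑' y, (T.sector y).indicator (fun _ =>
      ∑' y', T.kernelCoeff y y' / T.sectorMass α y' * (T.sector y').indicator 1 u) z := by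
  classical
  set E : V → ℝ≥0∞ := fun y =>
    ∑' y', T.kernelCoeff y y' / T.sectorMass α y' * (T.sector y').indicator 1 u with hE
  have h0 : ‖(T.sectorMass α T.root).toReal⁻¹‖ₑ ≤ 4 * E (T.parent^[T.level z] z) := by
    have hM := T.sectorMass_toReal_pos hα T.root
    rw [iterate_parent_level, hE]
    simp only [tsum_kernelCoeff_indicator]
    rw [Real.enorm_eq_ofReal_abs, abs_of_pos (inv_pos.2 hM), ENNReal.ofReal_inv_of_pos hM,
      ENNReal.ofReal_toReal (T.sectorMass_ne_top hα _), sector_root, Set.indicator_univ]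
    calc (T.sectorMass α T.root)⁻¹ = 1 * ((T.sectorMass α T.root)⁻¹ * (1 + 0)) := by simp
      _ ≤ _ := by
        gcongr
        · norm_num
        · exact le_rfl
        · exact bot_le
  have h1 : ∀ i ∈ Finset.range (T.level z),
      ‖T.radialValue (T.level z - i) i / T.radialNormSq α (T.level z - i) *
        T.harmonicRadial (T.parent^[i] z) u‖ₑ ≤ 4 * E (T.parent^[i] z) := by
    intro i hi
    have h := T.enorm_kernel_term_le hα (T.parent^[i] z) u i
    rwa [T.level_iterate_parent z (Finset.mem_range.1 hi).le] at h
  have hinj : Set.InjOn (fun i => T.parent^[i] z) (Finset.range (T.level z + 1)) := by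
    intro i hi j hj hij
    have hi' : i < T.level z + 1 := by simpa using hi
    have hj' : j < T.level z + 1 := by simpa using hj
    have h2 := T.level_iterate_parent z (Nat.lt_succ_iff.1 hi')
    have h3 := T.level_iterate_parent z (Nat.lt_succ_iff.1 hj')
    have h4 : T.parent^[i] z = T.parent^[j] z := hij
    rw [h4] at h2
    omega
  calc ‖T.explicitKernel α z u‖ₑ
      ≤ ‖(T.sectorMass α T.root).toReal⁻¹‖ₑ + ∑ i ∈ Finset.range (T.level z),
          ‖T.radialValue (T.level z - i) i / T.radialNormSq α (T.level z - i) *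
            T.harmonicRadial (T.parent^[i] z) u‖ₑ :=
        (enorm_add_le _ _).trans (add_le_add_right (enorm_sum_le _ _) _)
    _ ≤ 4 * E (T.parent^[T.level z] z) +
          ∑ i ∈ Finset.range (T.level z), 4 * E (T.parent^[i] z) :=
        add_le_add h0 (Finset.sum_le_sum h1)
    _ = 4 * ∑ i ∈ Finset.range (T.level z + 1), E (T.parent^[i] z) := by
        rw [Finset.sum_range_succ, mul_add, Finset.mul_sum, add_comm]
    _ = 4 * ∑ y ∈ (Finset.range (T.level z + 1)).image (fun i => T.parent^[i] z),
          (T.sector y).indicator (fun _ => E y) z := by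
        rw [Finset.sum_image hinj]
        congr 1
        refine Finset.sum_congr rfl fun i _ => ?_
        rw [Set.indicator_of_mem (T.mem_sector_iterate_parent z i)]
    _ ≤ _ := by
        gcongr
        exact ENNReal.sum_le_tsum _

theorem tsum_enorm_explicitKernel_mul_le {α : ℝ} (hα : 1 < α) (f : V → ℝ≥0∞) (z : V) :
    ∑' u, ‖T.explicitKernel α z u‖ₑ * f u ≤
      4 * T.dyadicOperator T.kernelCoeff (T.sectorMass α) f z := by
  calc ∑' u, ‖T.explicitKernel α z u‖ₑ * f u
      ≤ ∑' u, 4 * ((∑' y, (T.sector y).indicator (fun _ => ∑' y',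
          T.kernelCoeff y y' / T.sectorMass α y' * (T.sector y').indicator 1 u) z) * f u) :=
        ENNReal.tsum_le_tsum fun u => by
          rw [← mul_assoc]; gcongr; exact T.enorm_explicitKernel_le hα z u
    _ = 4 * ∑' y, ∑' u, (T.sector y).indicator (fun _ => ∑' y',
          T.kernelCoeff y y' / T.sectorMass α y' * (T.sector y').indicator 1 u) z * f u := by
        rw [ENNReal.tsum_mul_left]
        simp_rw [← ENNReal.tsum_mul_right]
        rw [ENNReal.tsum_comm]
    _ = _ := by
        rw [dyadicOperator]
        congr 1
        refine tsum_congr fun y => ?_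
        by_cases hz : z ∈ T.sector y
        · simp only [Set.indicator_of_mem hz, sectorSum, ← ENNReal.tsum_mul_left,
            ← ENNReal.tsum_mul_right]
          rw [ENNReal.tsum_comm]
          refine tsum_congr fun y' => tsum_congr fun u => ?_
          by_cases hu : u ∈ T.sector y' <;> simp [hu]
        · simp [hz]

theorem exists_bound_explicitKernel (α : ℝ) (z : V) : ∃ c, ∀ u, |T.explicitKernel α z u| ≤ c := by
  have hb : ∀ y u, |T.harmonicRadial y u| ≤
      2 * (1 + (T.q (T.level (T.parent y)) : ℝ)⁻¹ * ∑ _y' ∈ T.siblings y, 1) := by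
    intro y u
    have hq := T.q_pos (T.level (T.parent y))
    have h1 : ∀ y', (T.sector y').indicator (1 : V → ℝ) u ≤ 1 := fun y' =>
      Set.indicator_le_self' (by simp) u
    refine (T.abs_harmonicRadial_le y u).trans ?_
    gcongr
    · exact h1 y
    · exact h1 _
  refine ⟨|(T.sectorMass α T.root).toReal⁻¹| + ∑ i ∈ Finset.range (T.level z),
    |T.radialValue (T.level z - i) i / T.radialNormSq α (T.level z - i)| *
      (2 * (1 + (T.q (T.level (T.parent (T.parent^[i] z))) : ℝ)⁻¹ *
        ∑ _y' ∈ T.siblings (T.parent^[i] z), 1)), fun u => ?_⟩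
  refine (abs_add_le _ _).trans (add_le_add_right ((Finset.abs_sum_le_sum_abs _ _).trans
    (Finset.sum_le_sum fun i _ => ?_)) _)
  rw [abs_mul]
  gcongr
  exact hb _ u

/-! ### The Bergman projection -/

section Projection

variable [MeasurableSpace V]

theorem inner_toLp (α : ℝ) {g : V → ℝ} (hg : MemLp g 2 (T.measure α))
    (f : Lp ℝ 2 (T.measure α)) : inner ℝ (hg.toLp g) f = ∫ u, f u * g u ∂T.measure α := by
  rw [L2.inner_def]
  refine integral_congr_ae ?_
  filter_upwards [hg.coeFn_toLp] with u hu
  rw [hu]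
  rfl

variable [DiscreteMeasurableSpace V]

theorem integrable_iff_tsum {α : ℝ} {f : V → ℝ} :
    Integrable f (T.measure α) ↔ ∑' x, ‖f x‖ₑ * T.emass α x < ∞ := by
  rw [Integrable, HasFiniteIntegral, lintegral_measure, and_iff_right]
  exact (Measurable.of_discrete : Measurable f).aestronglyMeasurable

theorem hasSum_integral {α : ℝ} {f : V → ℝ} (hf : Integrable f (T.measure α)) :
    HasSum (fun x => T.mass α x * f x) (∫ x, f x ∂T.measure α) := by
  have h := hasSum_integral_measure (μ := fun x => ENNReal.ofReal (T.mass α x) • Measure.dirac x) hf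
  refine h.congr_fun fun x => ?_
  rw [integral_smul_measure, integral_dirac, ENNReal.toReal_ofReal (T.mass_pos α x).le, smul_eq_mul]

theorem memLp_explicitKernel {α : ℝ} (hα : 1 < α) (z : V) :
    MemLp (T.explicitKernel α z) 2 (T.measure α) := by
  have := T.isFiniteMeasure_measure hα
  obtain ⟨c, hc⟩ := T.exists_bound_explicitKernel α z
  exact MemLp.of_bound (Measurable.of_discrete).aestronglyMeasurable c
    (Filter.Eventually.of_forall hc)

/-- Testing an element of `L²(μ)` against the indicator of a vertex. -/
theorem inner_indicator_singleton (α : ℝ) (z : V) (hz : T.measure α {z} ≠ ∞)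
    (f : Lp ℝ 2 (T.measure α)) :
    inner ℝ (indicatorConstLp 2 (MeasurableSet.of_discrete (s := {z})) hz (1 : ℝ)) f =
      T.mass α z * f z := by
  rw [L2.inner_indicatorConstLp_one, integral_singleton, measureReal_def, measure_singleton,
    ENNReal.toReal_ofReal (T.mass_pos α z).le, smul_eq_mul]

theorem bergmanKernel_eq {α : ℝ} (hα : 1 < α) (z u : V) :
    T.bergmanKernel α z u = T.explicitKernel α z u := by
  have := T.isFiniteMeasure_measure hα
  have hm := T.mass_pos α z
  have hG := T.memLp_explicitKernel hα z
  have hGc : ∀ u, hG.toLp (T.explicitKernel α z) u = T.explicitKernel α z u :=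
    fun u => T.eq_of_ae_eq hG.coeFn_toLp u
  have hcc : ∀ u, (T.mass α z • hG.toLp (T.explicitKernel α z)) u =
      T.mass α z * T.explicitKernel α z u := by
    intro u
    rw [T.eq_of_ae_eq (Lp.coeFn_smul (T.mass α z) (hG.toLp (T.explicitKernel α z))) u,
      Pi.smul_apply, hGc, smul_eq_mul]
  have hmem : hG.toLp (T.explicitKernel α z) ∈ T.bergmanSpace α := by
    intro x
    change T.laplacian (⇑(hG.toLp (T.explicitKernel α z))) x = 0
    rw [funext hGc]
    exact T.laplacian_explicitKernel α z x
  have key := Submodule.eq_starProjection_of_mem_of_inner_eq_zero (K := T.bergmanSpace α)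
    (u := indicatorConstLp 2 (MeasurableSet.of_discrete (s := {z}))
      (by simp [measure_singleton] : T.measure α {z} ≠ ∞) (1 : ℝ))
    (Submodule.smul_mem _ (T.mass α z) hmem) (by
      intro h hh
      have hi : Integrable (fun u => h u) (T.measure α) := (Lp.memLp h).integrable one_le_two
      have hi2 : Integrable (fun u => h u * T.explicitKernel α z u) (T.measure α) :=
        (Lp.memLp h).integrable_mul hG
      have h1 := (T.hasSum_integral hi2).tsum_eq
      simp_rw [← mul_assoc] at h1
      rw [T.tsum_explicitKernel_mul hα hh (T.hasSum_integral hi).summable] at h1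
      rw [inner_sub_left, T.inner_indicator_singleton, real_inner_smul_left, T.inner_toLp, ← h1,
        sub_self])
  rw [bergmanKernel, bergmanProjection, key, hcc, inv_mul_cancel_left₀ hm.ne']

theorem bergmanProjection_eq_bergmanOperator {α : ℝ} (hα : 1 < α) {f : V → ℝ}
    (hf : MemLp f 2 (T.measure α)) (x : V) :
    T.bergmanProjection α (hf.toLp f) x = T.bergmanOperator α f x := by
  have hm := T.mass_pos α x
  have hG := T.memLp_explicitKernel hα x
  have hfin : T.measure α {x} ≠ ∞ := by simp [measure_singleton]
  have h1 := T.inner_indicator_singleton α x hfin (T.bergmanProjection α (hf.toLp f))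
  rw [bergmanProjection, ← Submodule.inner_starProjection_left_eq_right, real_inner_comm,
    T.inner_toLp] at h1
  have h2 : ∀ u, T.mass α x * (T.bergmanKernel α x u * f u) =
      (T.bergmanSpace α).starProjection (indicatorConstLp 2
        (MeasurableSet.of_discrete (s := {x})) hfin (1 : ℝ)) u * f u := by
    intro u
    rw [bergmanKernel, ← mul_assoc, mul_inv_cancel_left₀ hm.ne']
    rfl
  simp_rw [← h2] at h1
  rw [integral_const_mul] at h1
  exact (mul_left_cancel₀ hm.ne' h1).symm

theorem lintegral_weightedMeasure (α : ℝ) (w : V → ℝ) (f : V → ℝ≥0∞) :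
    ∫⁻ x, f x ∂T.weightedMeasure α w = ∑' x, f x * T.weightMass α w x := by
  rw [weightedMeasure, lintegral_withDensity_eq_lintegral_mul _ Measurable.of_discrete
    Measurable.of_discrete, lintegral_measure]
  refine tsum_congr fun x => ?_
  rw [Pi.mul_apply, weightMass]
  ring

theorem eLpNorm_weightedMeasure {p : ℝ} (hp : 0 < p) (α : ℝ) (w f : V → ℝ) :
    eLpNorm f (ENNReal.ofReal p) (T.weightedMeasure α w) =
      (∑' x, ‖f x‖ₑ ^ p * T.weightMass α w x) ^ (1 / p) := by
  rw [eLpNorm_eq_lintegral_rpow_enorm_toReal (ENNReal.ofReal_pos.2 hp).ne' ENNReal.ofReal_ne_top,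
    ENNReal.toReal_ofReal hp.le, lintegral_weightedMeasure]

end Projection

end RadialTree

end

theorem theoremB (p α : ℝ) (hp : 1 < p) (hα : 1 < α) :
    ∃ C : ℝ, 0 < C ∧
      ∀ (V : Type*) [MeasurableSpace V] [DiscreteMeasurableSpace V] (T : RadialTree V),
      ∀ w ∈ T.siblingWeights α p,
        T.weightConst α p w ≤ T.siblingWeightConst α p w ∧
        ∀ f : V → ℝ, MemLp f (ENNReal.ofReal p) (T.weightedMeasure α w) →
          (∀ x, Integrable (fun y => T.bergmanKernel α x y * f y) (T.measure α)) ∧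
          (∀ (hf : MemLp f 2 (T.measure α)) (x : V),
            T.bergmanProjection α (hf.toLp f) x = T.bergmanOperator α f x) ∧
          MemLp (T.bergmanOperator α f) (ENNReal.ofReal p) (T.weightedMeasure α w) ∧
          eLpNorm (T.bergmanOperator α f) (ENNReal.ofReal p) (T.weightedMeasure α w) ≤
            ENNReal.ofReal C * T.siblingWeightConst α p w ^ (1 / p) *
              T.weightConst α p w ^ (p.conjExponent / p ^ 2 + 1 / p.conjExponent) *
              eLpNorm f (ENNReal.ofReal p) (T.weightedMeasure α w) := by
  have hpq := Real.HolderConjugate.conjExponent hp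
  have hq0 := hpq.symm.pos
  have hp0 := hpq.pos
  set K := 4 * RadialTree.weightedBound α p with hK
  have hKt : K ≠ ∞ := ENNReal.mul_ne_top (by simp) (RadialTree.weightedBound_ne_top hα hp)
  refine ⟨K.toReal + 1, by positivity, ?_⟩
  intro V _ _ T w hw
  have hBD := T.weightConst_le_siblingWeightConst (w := w) hα hp
  refine ⟨hBD, fun f hf => ?_⟩
  have hDt : T.siblingWeightConst α p w ≠ ∞ := hw.2.ne
  have hBt : T.weightConst α p w ≠ ∞ := ne_top_of_le_ne_top hDt hBD
  have hft := hf.eLpNorm_ne_top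
  rw [T.eLpNorm_weightedMeasure hp0] at hft
  have hft' : ∑' z, ‖f z‖ₑ ^ p * T.weightMass α w z ≠ ∞ := by
    intro h
    rw [h, ENNReal.top_rpow_of_pos (by positivity)] at hft
    exact hft rfl
  have key := T.dyadicOperator_weighted_le hα hp hw hft'
  set Φ := T.dyadicOperator T.kernelCoeff (T.sectorMass α) (fun z => ‖f z‖ₑ * T.emass α z) with hΦ
  set R := RadialTree.weightedBound α p * T.siblingWeightConst α p w ^ (1 / p) *
        T.weightConst α p w ^ (p.conjExponent / p ^ 2 + 1 / p.conjExponent) *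
        (∑' z, ‖f z‖ₑ ^ p * T.weightMass α w z) ^ (1 / p) with hR
  have hRt : R ≠ ∞ := by
    refine ENNReal.mul_ne_top (ENNReal.mul_ne_top (ENNReal.mul_ne_top
      (RadialTree.weightedBound_ne_top hα hp) ?_) ?_) hft
    · exact ENNReal.rpow_ne_top_of_nonneg (by positivity) hDt
    · exact ENNReal.rpow_ne_top_of_nonneg (by positivity) hBt
  have habs : ∀ x, ∑' y, ‖T.bergmanKernel α x y * f y‖ₑ * T.emass α y ≤ 4 * Φ x := by
    intro x
    simp_rw [enorm_mul, mul_assoc, T.bergmanKernel_eq hα]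
    exact T.tsum_enorm_explicitKernel_mul_le hα (fun z => ‖f z‖ₑ * T.emass α z) x
  have hΦt : ∀ x, Φ x ≠ ∞ := by
    intro x hx
    have h1 : ∑' z, Φ z ^ p * T.weightMass α w z = ∞ := by
      refine ENNReal.tsum_eq_top_of_eq_top ⟨x, ?_⟩
      rw [hx, ENNReal.top_rpow_of_pos hp0, ENNReal.top_mul (T.weightMass_ne_zero hw.1 x)]
    rw [h1, ENNReal.top_rpow_of_pos (by positivity), top_le_iff] at key
    exact hRt key
  have hnorm : eLpNorm (T.bergmanOperator α f) (ENNReal.ofReal p) (T.weightedMeasure α w) ≤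
      4 * R := by
    rw [T.eLpNorm_weightedMeasure hp0]
    calc (∑' x, ‖T.bergmanOperator α f x‖ₑ ^ p * T.weightMass α w x) ^ (1 / p)
        ≤ (∑' x, 4 ^ p * (Φ x ^ p * T.weightMass α w x)) ^ (1 / p) := by
          refine ENNReal.rpow_le_rpow (ENNReal.tsum_le_tsum fun x => ?_) (by positivity)
          rw [← mul_assoc, ← ENNReal.mul_rpow_of_nonneg _ _ hp0.le]
          refine mul_le_mul_left (ENNReal.rpow_le_rpow ?_ hp0.le) _
          refine (enorm_integral_le_lintegral_enorm _).trans ?_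
          rw [T.lintegral_measure]
          exact habs x
      _ = 4 * (∑' x, Φ x ^ p * T.weightMass α w x) ^ (1 / p) := by
          rw [ENNReal.tsum_mul_left, ENNReal.mul_rpow_of_nonneg _ _ (by positivity),
            ← ENNReal.rpow_mul, mul_one_div_cancel hp0.ne', ENNReal.rpow_one]
      _ ≤ 4 * R := by gcongr
  refine ⟨fun x => ?_, fun hf2 x => T.bergmanProjection_eq_bergmanOperator hα hf2 x,
    ⟨(Measurable.of_discrete).aestronglyMeasurable, ?_⟩, hnorm.trans ?_⟩
  · rw [T.integrable_iff_tsum]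
    exact (habs x).trans_lt (ENNReal.mul_ne_top (by simp) (hΦt x)).lt_top
  · exact hnorm.trans_lt (ENNReal.mul_ne_top (by simp) hRt).lt_top
  · have hKC : K ≤ ENNReal.ofReal (K.toReal + 1) := by
      conv_lhs => rw [← ENNReal.ofReal_toReal hKt]
      exact ENNReal.ofReal_le_ofReal (by linarith)
    rw [T.eLpNorm_weightedMeasure hp0, hR, ← mul_assoc, ← mul_assoc, ← mul_assoc, ← hK]
    gcongr
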